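/- **Theorem 6.1 (Katz dimension formula).** Let $V$ be a finite-dimensional complex vector space, let $\mathbb P(V)=\mathbb P^n$ be the projective space of lines in $V$, and let $X\subset\mathbb P(V)$ be a (non-empty) irreducible Zariski-closed subset of dimension $k$. For a point $x\in X$ let $\hat T_xX$ be the embedded tangent space of $X$ at $x$, that is, the projectivization of the Zariski tangent space of the affine cone over $X$ at a non-zero point of the line $x$. The dual variety $X^*\subset\mathbb P(V^*)$ is the Zariski closure of the set of hyperplanes that contain $\hat T_xX$ for some smooth point $x$ of $X$, and the defect of $X$ is $\operatorname{def}(X)=\operatorname{codim}_{\mathbb P(V^*)}X^*-1$, where the empty set has dimension $-1$. For a point $x_0\in X$ let $x_0^\perp\subset V^*$ be the space of linear forms vanishing on the line $x_0$. Consider all choices of a smooth point $x_0$ of $X$, of linear forms $T_0\in V^*\setminus x_0^\perp$ and $T_1,\dots,T_k\in x_0^\perp$ such that $t_i=T_i/T_0$ $(1\le i\le k)$ are local analytic coordinates on $X$ near $x_0$, and of a linear form $U\in x_0^\perp$. For each such choice, $u=U/T_0$ restricted to $X$ near $x_0$ is an analytic function of $t_1,\dots,t_k$; put $$\operatorname{Hes}(u)=\operatorname{Hes}(U;T_0,T_1,\dots,T_k;x_0)=\left(\frac{\partial^2u}{\partial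 t_i\,\partial t_j}(0,\dots,0)\right)_{i,j=1,\dots,k}.$$ Then: (a) $\operatorname{def}(X)=\min\operatorname{corank}\operatorname{Hes}(u)$, the minimum being taken over all these choices, where $\operatorname{corank}\operatorname{Hes}(u)=k-\operatorname{rank}\operatorname{Hes}(u)$. (b) $X^*$ is a hypersurface (the zero locus in $\mathbb P(V^*)$ of a non-zero homogeneous polynomial of positive degree) if and only if $\operatorname{Hes}(u)$ is invertible for at least one of these choices. -/

import Mathlib

open scoped LinearAlgebra.Projectivization Topology

noncomputable section

namespace KatzDuality

section Projective

variable {W : Type*} [AddCommGroup W] [Module ℂ W]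

/-- The algebra of polynomial functions on a complex vector space: the functions generated, as a
`ℂ`-algebra, by the linear forms. -/
def polyFun (W : Type*) [AddCommGroup W] [Module ℂ W] : Subalgebra ℂ (W → ℂ) :=
  Algebra.adjoin ℂ (Set.range fun (φ : Module.Dual ℂ W) (w : W) => φ w)

/-- The coordinate ring of a subset `C` of a complex vector space: the algebra of restrictions
to `C` of polynomial functions. -/
def coordinateRing (C : Set W) : Subalgebra ℂ (C → ℂ) :=
  Algebra.adjoin ℂ (Set.range fun (φ : Module.Dual ℂ W) (w : C) => φ w)

/-- `f` is a form (homogeneous polynomial function) of degree `d`. -/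
def IsForm (d : ℕ) (f : W → ℂ) : Prop :=
  f ∈ polyFun W ∧ ∀ (c : ℂ) (w : W), f (c • w) = c ^ d * f w

/-- The set of points of projective space (lines in `W`) on which `f` vanishes. -/
def zeroLocus (f : W → ℂ) : Set (ℙ ℂ W) :=
  {p | ∀ w ∈ p.submodule, f w = 0}

/-- The Zariski topology on projective space: the complements of the zero loci of forms
are a basis of open sets. -/
abbrev zariskiTopology (W : Type*) [AddCommGroup W] [Module ℂ W] : TopologicalSpace (ℙ ℂ W) :=
  TopologicalSpace.generateFrom {O | ∃ (d : ℕ) (f : W → ℂ), IsForm d f ∧ O = (zeroLocus f)ᶜ}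

/-- Irreducible (in particular non-empty) projective varieties. -/
def IsProjectiveVariety (X : Set (ℙ ℂ W)) : Prop :=
  IsClosed[zariskiTopology W] X ∧ @IsIrreducible _ (zariskiTopology W) X

/-- The affine cone over `Y`: the union of the lines that belong to `Y`, together with the vertex
`0` (so that the cone over the empty set is `{0}`). -/
def cone (Y : Set (ℙ ℂ W)) : Set W :=
  {w | ∀ hw : w ≠ 0, Projectivization.mk ℂ w hw ∈ Y}

/-- The dimension of a projective algebraic set: one less than the Krull dimension of its
homogeneous coordinate ring, the coordinate ring of its affine cone. (It is finite for
finite-dimensional `W`, and the empty set has dimension `-1`.) -/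
def dim (Y : Set (ℙ ℂ W)) : ℤ :=
  (((ringKrullDim (coordinateRing (cone Y))).unbotD 0).toNat : ℤ) - 1

/-- The codimension of `Y` in the projective space `ℙ ℂ W` of dimension `dim W - 1`. -/
def codim (Y : Set (ℙ ℂ W)) : ℤ :=
  ((Module.finrank ℂ W : ℤ) - 1) - dim Y

/-- A hypersurface: the zero locus of a non-zero form of positive degree. -/
def IsHypersurface (Y : Set (ℙ ℂ W)) : Prop :=
  ∃ (d : ℕ) (f : W → ℂ), 0 < d ∧ IsForm d f ∧ f ≠ 0 ∧ Y = zeroLocus f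

end Projective

section Dual

variable {V : Type*} [NormedAddCommGroup V] [NormedSpace ℂ V]

/-- The Zariski tangent space at `v` of the affine cone over `X`, as a linear subspace of `V`:
the common kernel of the differentials at `v` of all polynomial functions vanishing on the cone. -/
def coneTangentSpace (X : Set (ℙ ℂ V)) (v : V) : Submodule ℂ V :=
  ⨅ f ∈ {f : V → ℂ | f ∈ polyFun V ∧ ∀ w ∈ cone X, f w = 0},
    LinearMap.ker (fderiv ℂ f v).toLinearMap

/-- The embedded tangent space of `X` at `x`, as a linear subspace of `V`
(it does not depend on the non-zero point chosen on the line `x`). -/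
def embeddedTangentSpace (X : Set (ℙ ℂ V)) (x : ℙ ℂ V) : Submodule ℂ V :=
  coneTangentSpace X x.rep

/-- Smooth points of an irreducible variety. -/
def IsSmoothPoint (X : Set (ℙ ℂ V)) (x : ℙ ℂ V) : Prop :=
  x ∈ X ∧ (Module.finrank ℂ (embeddedTangentSpace X x) : ℤ) = dim X + 1

/-- The hyperplane `H`, a point of the dual projective space, contains the embedded tangent space
at some smooth point of `X`. -/
def IsTangentHyperplane (X : Set (ℙ ℂ V)) (H : ℙ ℂ (Module.Dual ℂ V)) : Prop :=
  ∃ x, IsSmoothPoint X x ∧ ∀ w ∈ embeddedTangentSpace X x, H.rep w = 0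

/-- The projectively dual variety: the Zariski closure of the set of tangent hyperplanes. -/
def dualVariety (X : Set (ℙ ℂ V)) : Set (ℙ ℂ (Module.Dual ℂ V)) :=
  closure[zariskiTopology (Module.Dual ℂ V)] {H | IsTangentHyperplane X H}

/-- The defect of `X`. -/
def defect (X : Set (ℙ ℂ V)) : ℤ :=
  codim (dualVariety X) - 1

/-- The functions `t i = T i / T₀` are local (analytic) coordinates, centred at `x₀`, on `X` near
`x₀`, and `G` is the inverse of the chart `t`, where the points of `X` off the hyperplane `T₀ = 0`
are represented by the vectors `v` in the cone over `X` with `T₀ v = 1`. -/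
structure IsLocalChart {k : ℕ} (X : Set (ℙ ℂ V)) (x₀ : ℙ ℂ V) (T₀ : Module.Dual ℂ V)
    (T : Fin k → Module.Dual ℂ V) (G : (Fin k → ℂ) → V) : Prop where
  not_mem_perp : T₀ ∉ x₀.submodule.dualAnnihilator
  mem_perp : ∀ i, T i ∈ x₀.submodule.dualAnnihilator
  center : G 0 ∈ x₀.submodule
  analytic : AnalyticAt ℂ G 0
  maps_to : ∀ᶠ t in 𝓝 (0 : Fin k → ℂ), G t ∈ cone X ∧ T₀ (G t) = 1
  right_inv : ∀ᶠ t in 𝓝 (0 : Fin k → ℂ), ∀ i, T i (G t) / T₀ (G t) = t i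
  left_inv : ∀ᶠ v in 𝓝 (G 0), v ∈ cone X → T₀ v = 1 → G (fun i => T i v / T₀ v) = v

/-- The matrix of second partial derivatives of `u` at the origin. -/
def hessianMatrix {k : ℕ} (u : (Fin k → ℂ) → ℂ) : Matrix (Fin k) (Fin k) ℂ :=
  Matrix.of fun i j =>
    fderiv ℂ (fun t => fderiv ℂ u t (Pi.single j 1)) 0 (Pi.single i 1)

/-- `M` is one of the matrices `Hes(U; T₀, T₁, …, T_k; x₀)`: the Hessian matrix at the origin of
`u = U / T₀`, written as a function of the local coordinates `t₁, …, t_k` on `X`, for some smooth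
point `x₀` of `X`, some local coordinates `t i = T i / T₀` at `x₀` and some linear form `U`
vanishing at `x₀`. -/
def IsLocalHessian {k : ℕ} (X : Set (ℙ ℂ V)) (M : Matrix (Fin k) (Fin k) ℂ) : Prop :=
  ∃ (x₀ : ℙ ℂ V) (T₀ : Module.Dual ℂ V) (T : Fin k → Module.Dual ℂ V)
    (G : (Fin k → ℂ) → V) (U : Module.Dual ℂ V),
    IsSmoothPoint X x₀ ∧ IsLocalChart X x₀ T₀ T G ∧ U ∈ x₀.submodule.dualAnnihilator ∧
      M = hessianMatrix fun t => U (G t) / T₀ (G t)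

end Dual

end KatzDuality

end

/-! Let `Z` be the cone over `X`, of dimension `k + 1`, and let `F 1, …, F s` generate its ideal. A
polynomial function vanishes on the cone over `X^*` exactly when its pullback under the conormal map
`(v, c) ↦ ∑ c i • dF i (v)` vanishes on `Z × ℂ^s` (`vanishes_on_dual_cone_iff_conormalMap`). So the
dual cone is irreducible, and its dimension is the generic rank of the conormal map. For `f = ∑ c i
• F i` the derivative of this map at `(v, c)` takes tangent vectors of `Z × ℂ^s` into `N +
f''(v)(T)`, where `T` is the tangent space of `Z` at `v` and `N` its annihilator
(`conormalTangent`).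

The Hessian enters through this space. Along a chart `G`, differentiating `df(G)(∂_j G) = 0` gives
`f''(∂_i G, ∂_j G) = -df(∂_i ∂_j G)`, which is minus the Hessian of `u = df(v) / T₀`. Moreover
`f''(v)` pairs `v` to zero with `T`. Linear algebra (`finrank_conormal_sup_map`) then gives the
dimension of `N + f''(v)(T)` as `dim V - (k + 1) + rank Hes(u)`. An arbitrary `U` is corrected by a
combination of the `T l` to a conormal vector with the same Hessian
(`IsLocalChart.exists_conormal`).

At the centre of every smooth chart this dimension is at most that of the dual cone
(`finrank_conormalTangent_le`): a submersion has open image near a point, and a nonzero polynomial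
cannot vanish on an open set. At a general `(v, c)` it is at least that of the dual cone
(`exists_generic_affineDim_le`). Hence the dual cone has dimension `dim V - (k + 1) + max rank
Hes(u)`, which is (a). For (b), codimension one means maximal rank `k`, and for the closed
irreducible set `X^*` codimension one is the same as being a hypersurface
(`isHypersurface_of_affineDim`, `IsHypersurface.affineDim_add_one`).

The generic statements rest on `exists_generic_chart`: off a proper algebraic subset, a
transcendence basis of the coordinate ring is a system of analytic coordinates, by a primitive
element and the implicit function theorem. -/

namespace KatzDuality

/-! ### Polynomial functions and coordinate rings. -/

section PolyFun

variable {W W' : Type*} [AddCommGroup W] [Module ℂ W] [AddCommGroup W'] [Module ℂ W']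

theorem linear_mem_polyFun (φ : Module.Dual ℂ W) : (fun w => φ w) ∈ polyFun W :=
  Algebra.subset_adjoin ⟨φ, rfl⟩

theorem const_mem_polyFun (c : ℂ) : (fun _ => c) ∈ polyFun W :=
  (polyFun W).algebraMap_mem c

@[elab_as_elim]
theorem polyFun_induction {motive : (f : W → ℂ) → f ∈ polyFun W → Prop}
    (linear : ∀ φ : Module.Dual ℂ W, motive (fun w => φ w) (linear_mem_polyFun φ))
    (const : ∀ c : ℂ, motive (fun _ => c) (const_mem_polyFun c))
    (add : ∀ f g (hf : f ∈ polyFun W) (hg : g ∈ polyFun W), motive f hf → motive g hg →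
      motive (fun w => f w + g w) (add_mem hf hg))
    (mul : ∀ f g (hf : f ∈ polyFun W) (hg : g ∈ polyFun W), motive f hf → motive g hg →
      motive (fun w => f w * g w) (mul_mem hf hg))
    {f : W → ℂ} (hf : f ∈ polyFun W) : motive f hf := by
  unfold polyFun at *
  induction hf using Algebra.adjoin_induction with
  | mem x hx => obtain ⟨φ, rfl⟩ := hx; exact linear φ
  | algebraMap c => exact const c
  | add f g hf hg h1 h2 => exact add f g hf hg h1 h2
  | mul f g hf hg h1 h2 => exact mul f g hf hg h1 h2

theorem polyFun_comp_linear {f : W → ℂ} (hf : f ∈ polyFun W) (L : W' →ₗ[ℂ] W) :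
    (fun w => f (L w)) ∈ polyFun W' := by
  induction hf using polyFun_induction with
  | linear φ => exact linear_mem_polyFun (φ ∘ₗ L)
  | const c => exact const_mem_polyFun c
  | add f g _ _ h1 h2 => exact add_mem h1 h2
  | mul f g _ _ h1 h2 => exact mul_mem h1 h2

theorem polyFun_sum_mem {ι : Type*} (s : Finset ι) {f : ι → W → ℂ}
    (hf : ∀ i ∈ s, f i ∈ polyFun W) : (fun w => ∑ i ∈ s, f i w) ∈ polyFun W := by
  have := sum_mem hf
  convert this using 1
  ext w; simp

theorem aeval_mem_polyFun {σ : Type*} {y : σ → W → ℂ} (hy : ∀ i, y i ∈ polyFun W)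
    (p : MvPolynomial σ ℂ) : (fun w => MvPolynomial.eval (fun i => y i w) p) ∈ polyFun W := by
  induction p using MvPolynomial.induction_on with
  | C a => simpa using const_mem_polyFun a
  | add p q hp hq => simp only [map_add]; exact add_mem hp hq
  | mul_X p i hp => simp only [map_mul, MvPolynomial.eval_X]; exact mul_mem hp (hy i)

theorem exists_mvPolynomial_of_mem_polyFun {ι : Type*} [Finite ι] (b : Module.Basis ι ℂ W)
    {f : W → ℂ} (hf : f ∈ polyFun W) :
    ∃ p : MvPolynomial ι ℂ, ∀ w, f w = MvPolynomial.eval (fun i => b.coord i w) p := by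
  have := Fintype.ofFinite ι
  induction hf using polyFun_induction with
  | linear φ =>
    refine ⟨∑ i, MvPolynomial.C (φ (b i)) * MvPolynomial.X i, fun w => ?_⟩
    have := congrArg φ (b.sum_repr w)
    refine this.symm.trans ?_
    rw [map_sum, map_sum]
    simp [mul_comm]
  | const c => exact ⟨MvPolynomial.C c, by simp⟩
  | add f g _ _ h1 h2 =>
    obtain ⟨p, hp⟩ := h1
    obtain ⟨q, hq⟩ := h2
    exact ⟨p + q, by simp [hp, hq]⟩
  | mul f g _ _ h1 h2 =>
    obtain ⟨p, hp⟩ := h1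
    obtain ⟨q, hq⟩ := h2
    exact ⟨p * q, by simp [hp, hq]⟩

theorem isForm_of_isHomogeneous {ι : Type*} [Finite ι] (b : Module.Basis ι ℂ W)
    {p : MvPolynomial ι ℂ} {d : ℕ} (hp : p.IsHomogeneous d) :
    IsForm d (fun w => MvPolynomial.eval (fun i => b.coord i w) p) := by
  refine ⟨aeval_mem_polyFun (fun i => linear_mem_polyFun (b.coord i)) p, fun c w => ?_⟩
  have := Fintype.ofFinite ι
  simp only [map_smul, smul_eq_mul, MvPolynomial.eval_eq', Finset.mul_sum]
  refine Finset.sum_congr rfl fun s hs => ?_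
  have h1 : s.degree = d := by
    by_contra h
    exact (MvPolynomial.mem_support_iff.mp hs) (hp.coeff_eq_zero h)
  simp only [mul_pow, Finset.prod_mul_distrib, Finset.prod_pow_eq_pow_sum]
  rw [← h1, Finsupp.degree_eq_sum]
  ring

/-- A polynomial function is a sum of forms. -/
theorem exists_forms_of_mem_polyFun [FiniteDimensional ℂ W] {f : W → ℂ} (hf : f ∈ polyFun W) :
    ∃ (D : ℕ) (g : ℕ → W → ℂ), (∀ d, IsForm d (g d)) ∧
      ∀ (c : ℂ) (w : W), f (c • w) = ∑ d ∈ Finset.range D, c ^ d * g d w := by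
  obtain ⟨p, hp⟩ := exists_mvPolynomial_of_mem_polyFun (Module.finBasis ℂ W) hf
  have hg : ∀ d, IsForm d (fun w => MvPolynomial.eval (fun i => (Module.finBasis ℂ W).coord i w)
      (MvPolynomial.homogeneousComponent d p)) := fun d =>
    isForm_of_isHomogeneous _ (MvPolynomial.homogeneousComponent_isHomogeneous d p)
  refine ⟨p.totalDegree + 1, _, hg, fun c w => ?_⟩
  rw [hp, ← MvPolynomial.sum_homogeneousComponent p, map_sum,
    MvPolynomial.sum_homogeneousComponent p]
  exact Finset.sum_congr rfl fun d _ => (hg d).2 c w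

theorem polyFun_isNoetherianRing [FiniteDimensional ℂ W] : IsNoetherianRing (polyFun W) := by
  let b := Module.finBasis ℂ W
  let φ : MvPolynomial (Fin (Module.finrank ℂ W)) ℂ →ₐ[ℂ] polyFun W :=
    MvPolynomial.aeval fun i => ⟨fun w => b.coord i w, linear_mem_polyFun _⟩
  have hφ : ∀ p w, (φ p : W → ℂ) w = MvPolynomial.eval (fun i => b.coord i w) p := by
    intro p w
    induction p using MvPolynomial.induction_on with
    | C a => simp [φ]
    | add p q hp hq => simp [hp, hq]
    | mul_X p i hp => simp [hp]; left; simp [φ]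
  refine isNoetherianRing_of_surjective _ _ φ.toRingHom fun f => ?_
  obtain ⟨p, hp⟩ := exists_mvPolynomial_of_mem_polyFun b f.2
  exact ⟨p, Subtype.ext (funext fun w => (hφ p w).trans (hp w).symm)⟩

/-- The polynomial functions vanishing on a set are generated by finitely many of them. -/
theorem exists_finite_generators [FiniteDimensional ℂ W] (Z : Set W) :
    ∃ (s : ℕ) (F : Fin s → W → ℂ), (∀ i, F i ∈ polyFun W ∧ ∀ z ∈ Z, F i z = 0) ∧
      ∀ f ∈ polyFun W, (∀ z ∈ Z, f z = 0) →
        ∃ a : Fin s → W → ℂ, (∀ i, a i ∈ polyFun W) ∧ ∀ w, f w = ∑ i, a i w * F i w := by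
  have := polyFun_isNoetherianRing (W := W)
  let I : Ideal (polyFun W) :=
    { carrier := {f | ∀ z ∈ Z, (f : W → ℂ) z = 0}
      add_mem' := fun {a b} ha hb z hz => by simp [ha z hz, hb z hz]
      zero_mem' := fun z _ => rfl
      smul_mem' := fun c f hf z hz => by simp [hf z hz] }
  obtain ⟨s, F, hF⟩ := Submodule.fg_iff_exists_fin_generating_family.mp
    (IsNoetherian.noetherian I)
  refine ⟨s, fun i => F i, fun i => ⟨(F i).2, ?_⟩, fun f hf hfz => ?_⟩
  · have : F i ∈ I := hF ▸ Submodule.subset_span ⟨i, rfl⟩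
    exact this
  · have : (⟨f, hf⟩ : polyFun W) ∈ Submodule.span (polyFun W) (Set.range F) := by
      rw [hF]; exact hfz
    obtain ⟨c, hc⟩ := (Submodule.mem_span_range_iff_exists_fun _).mp this
    refine ⟨fun i => c i, fun i => (c i).2, fun w => ?_⟩
    have := congrArg (fun g : polyFun W => (g : W → ℂ) w) hc
    simp only at this
    rw [← this]
    simp

theorem mem_coordinateRing_iff {Z : Set W} {g : Z → ℂ} :
    g ∈ coordinateRing Z ↔ ∃ f ∈ polyFun W, ∀ z : Z, g z = f z := by
  constructor
  · intro hg
    unfold coordinateRing at hg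
    induction hg using Algebra.adjoin_induction with
    | mem x hx => obtain ⟨φ, rfl⟩ := hx; exact ⟨_, linear_mem_polyFun φ, fun _ => rfl⟩
    | algebraMap c => exact ⟨_, const_mem_polyFun c, fun _ => rfl⟩
    | add f g _ _ h1 h2 =>
      obtain ⟨f', hf, hf'⟩ := h1
      obtain ⟨g', hg, hg'⟩ := h2
      exact ⟨_, add_mem hf hg, by simp [hf', hg']⟩
    | mul f g _ _ h1 h2 =>
      obtain ⟨f', hf, hf'⟩ := h1
      obtain ⟨g', hg, hg'⟩ := h2
      exact ⟨_, mul_mem hf hg, by simp [hf', hg']⟩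
  · rintro ⟨f, hf, hgf⟩
    obtain rfl : g = fun z : Z => f z := funext hgf
    induction hf using polyFun_induction with
    | linear φ => exact Algebra.subset_adjoin ⟨φ, rfl⟩
    | const c => exact (coordinateRing Z).algebraMap_mem c
    | add f g _ _ h1 h2 => exact add_mem (h1 fun _ => rfl) (h2 fun _ => rfl)
    | mul f g _ _ h1 h2 => exact mul_mem (h1 fun _ => rfl) (h2 fun _ => rfl)

/-- Restriction of polynomial functions to a subset. -/
noncomputable def restrictHom (Z : Set W) : polyFun W →ₐ[ℂ] coordinateRing Z where
  toFun f := ⟨fun z => (f : W → ℂ) z, mem_coordinateRing_iff.mpr ⟨f, f.2, fun _ => rfl⟩⟩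
  map_one' := rfl
  map_mul' _ _ := rfl
  map_zero' := rfl
  map_add' _ _ := rfl
  commutes' _ := rfl

theorem restrictHom_surjective (Z : Set W) : Function.Surjective (restrictHom Z) := by
  intro g
  obtain ⟨f, hf, h⟩ := mem_coordinateRing_iff.mp g.2
  exact ⟨⟨f, hf⟩, Subtype.ext (funext fun z => (h z).symm)⟩

theorem coordinateRing_aeval_apply {Z : Set W} {σ : Type*} (y : σ → coordinateRing Z)
    (p : MvPolynomial σ ℂ) (z : Z) :
    (MvPolynomial.aeval y p : coordinateRing Z).1 z
      = MvPolynomial.eval (fun i => (y i).1 z) p := by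
  induction p using MvPolynomial.induction_on with
  | C a => simp
  | add p q hp hq => simp [hp, hq]
  | mul_X p i hp => simp [hp]

theorem coordinateRing_adjoin_linear (Z : Set W) :
    Algebra.adjoin ℂ (Set.range fun φ : Module.Dual ℂ W =>
      restrictHom Z ⟨fun w => φ w, linear_mem_polyFun φ⟩) = ⊤ := by
  apply Subalgebra.map_injective (f := (coordinateRing Z).val) Subtype.val_injective
  rw [← Algebra.adjoin_image, ← Set.range_comp, Algebra.map_top, Subalgebra.range_val]
  rfl

theorem coordinateRing_finiteType [FiniteDimensional ℂ W] (Z : Set W) :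
    Algebra.FiniteType ℂ (coordinateRing Z) := by
  let b := Module.finBasis ℂ W
  let φ : MvPolynomial (Fin (Module.finrank ℂ W)) ℂ →ₐ[ℂ] coordinateRing Z :=
    MvPolynomial.aeval fun i => restrictHom Z ⟨fun w => b.coord i w, linear_mem_polyFun _⟩
  refine Algebra.FiniteType.of_surjective φ fun g => ?_
  obtain ⟨f, hf, h⟩ := mem_coordinateRing_iff.mp g.2
  obtain ⟨p, hp⟩ := exists_mvPolynomial_of_mem_polyFun b hf
  refine ⟨p, Subtype.ext (funext fun z => ?_)⟩
  rw [h, hp]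
  exact coordinateRing_aeval_apply _ p z

end PolyFun

/-! ### Analyticity and derivatives of polynomial functions. -/

section Calculus

variable {W : Type*} [NormedAddCommGroup W] [NormedSpace ℂ W] [FiniteDimensional ℂ W]

theorem analyticAt_linear (φ : Module.Dual ℂ W) (w : W) : AnalyticAt ℂ (fun w => φ w) w :=
  φ.toContinuousLinearMap.analyticAt w

theorem analyticAt_of_mem_polyFun {f : W → ℂ} (hf : f ∈ polyFun W) (w : W) :
    AnalyticAt ℂ f w := by
  induction hf using polyFun_induction with
  | linear φ => exact analyticAt_linear φ w
  | const c => exact analyticAt_const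
  | add f g _ _ h1 h2 => exact h1.add h2
  | mul f g _ _ h1 h2 => exact h1.mul h2

theorem differentiableAt_of_mem_polyFun {f : W → ℂ} (hf : f ∈ polyFun W) (w : W) :
    DifferentiableAt ℂ f w := (analyticAt_of_mem_polyFun hf w).differentiableAt

theorem fderiv_mem_polyFun {f : W → ℂ} (hf : f ∈ polyFun W) (u : W) :
    (fun w => fderiv ℂ f w u) ∈ polyFun W := by
  induction hf using polyFun_induction with
  | linear φ =>
    have : (fun w => fderiv ℂ (fun w => φ w) w u) = fun _ => φ u := by
      ext w
      have : HasFDerivAt (fun w => φ w) φ.toContinuousLinearMap w :=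
        φ.toContinuousLinearMap.hasFDerivAt
      rw [this.fderiv]
      rfl
    rw [this]
    exact const_mem_polyFun _
  | const c => simpa using const_mem_polyFun 0
  | add f g hf hg h1 h2 =>
    convert add_mem h1 h2 using 1
    ext w
    rw [fderiv_fun_add (differentiableAt_of_mem_polyFun hf w)
      (differentiableAt_of_mem_polyFun hg w)]
    rfl
  | mul f g hf hg h1 h2 =>
    convert add_mem (mul_mem hf h2) (mul_mem hg h1) using 1
    ext w
    rw [fderiv_fun_mul (differentiableAt_of_mem_polyFun hf w)
      (differentiableAt_of_mem_polyFun hg w)]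
    rfl

end Calculus

/-! ### Krull dimension and transcendence degree. -/

section Dimension

/-- Incomparability makes contraction of primes strictly monotone, which bounds the dimension of
`A`; lying over and going up lift chains of primes of `R`, which bounds that of `R`. -/
theorem ringKrullDim_eq_of_isIntegral (R A : Type*) [CommRing R] [CommRing A] [Algebra R A]
    [Algebra.IsIntegral R A] (hinj : Function.Injective (algebraMap R A)) :
    ringKrullDim A = ringKrullDim R := by
  apply le_antisymm
  · refine Order.krullDim_le_of_strictMono (PrimeSpectrum.comap (algebraMap R A)) fun p q hpq => ?_
    obtain ⟨hle, x, hxq, hxp⟩ := SetLike.lt_iff_le_and_exists.mp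
      (show p.asIdeal < q.asIdeal from hpq)
    exact Ideal.comap_lt_comap_of_integral_mem_sdiff hle ⟨hxq, hxp⟩
      (Algebra.IsIntegral.isIntegral x)
  · refine iSup_le fun l => ?_
    obtain ⟨Q, -, hQp, hQ⟩ := Ideal.exists_ideal_over_prime_of_isIntegral l.head.asIdeal
      (⊥ : Ideal A) (by
        rw [← RingHom.ker_eq_comap_bot, (RingHom.injective_iff_ker_eq_bot _).mp hinj]
        exact bot_le)
    have : Q.LiesOver l.head.asIdeal := ⟨hQ.symm⟩
    obtain ⟨L, hL, -⟩ := Ideal.exists_ltSeries_of_hasGoingUp l Q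
    rw [← hL]
    exact Order.LTSeries.length_le_krullDim L

/-- The Krull dimension of a domain of finite type over a field is its transcendence degree. -/
theorem ringKrullDim_eq_trdeg (F A : Type*) [Field F] [CommRing A] [IsDomain A] [Algebra F A]
    [Algebra.FiniteType F A] :
    ∃ n : ℕ, ringKrullDim A = n ∧ Algebra.trdeg F A = n := by
  -- Noether normalisation: both invariants of `A` agree with those of a polynomial ring in `n`
  -- variables.
  obtain ⟨n, g, hg, hint⟩ := exists_integral_inj_algHom_of_fg F A
  refine ⟨n, ?_, ?_⟩
  · let _ : Algebra (MvPolynomial (Fin n) F) A := g.toRingHom.toAlgebra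
    have : Algebra.IsIntegral (MvPolynomial (Fin n) F) A := ⟨hint⟩
    rw [ringKrullDim_eq_of_isIntegral (MvPolynomial (Fin n) F) A hg]
    simp
  · let _ : Algebra (MvPolynomial (Fin n) F) A := g.toRingHom.toAlgebra
    have : IsScalarTower F (MvPolynomial (Fin n) F) A :=
      IsScalarTower.of_algebraMap_eq fun x => (g.commutes x).symm
    have : Algebra.IsIntegral (MvPolynomial (Fin n) F) A := ⟨hint⟩
    have : FaithfulSMul (MvPolynomial (Fin n) F) A :=
      (faithfulSMul_iff_algebraMap_injective _ _).mpr hg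
    have h := (IsTranscendenceBasis.mvPolynomial (Fin n) F).algebraMap_comp (A := A)
    have := h.lift_cardinalMk_eq_trdeg
    simpa using this.symm

end Dimension

/-! ### Separable relations and primitive elements with cleared denominators. -/

section Separable

open Polynomial

variable {R A : Type*} [CommRing R] [IsDomain R] [CharZero R] [CommRing A] [IsDomain A]
  [Algebra R A] [FaithfulSMul R A] 

omit [IsDomain R] [CharZero R] in
theorem exists_map_eq_smul [Nontrivial R] (q : (FractionRing R)[X]) :
    ∃ r : R, r ≠ 0 ∧ ∃ Q : R[X], Q.map (algebraMap R (FractionRing R)) = r • q := by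
  obtain ⟨b, hb, h⟩ := IsLocalization.integerNormalization_spec (nonZeroDivisors R) q
  exact ⟨b, nonZeroDivisors.ne_zero hb, _, h⟩

-- A nonzero relation of least degree works: in characteristic zero its derivative is a nonzero
-- polynomial of smaller degree, so it cannot vanish at `a`.
omit [IsDomain A] in
theorem exists_separable_relation [Algebra.IsAlgebraic R A] (a : A) :
    ∃ P : R[X], aeval a P = 0 ∧ aeval a (derivative P) ≠ 0 := by
  classical
  have hex : ∃ n, ∃ P : R[X], P ≠ 0 ∧ aeval a P = 0 ∧ P.natDegree = n := by
    obtain ⟨P, h0, h1⟩ := Algebra.IsAlgebraic.isAlgebraic (R := R) a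
    exact ⟨_, P, h0, h1, rfl⟩
  obtain ⟨P, hP0, hPa, hPd⟩ := Nat.find_spec hex
  refine ⟨P, hPa, fun hd => ?_⟩
  have hdeg : P.natDegree ≠ 0 := by
    intro h
    rw [eq_C_of_natDegree_eq_zero h, aeval_C] at hPa
    have := (FaithfulSMul.algebraMap_injective R A) (hPa.trans (map_zero _).symm)
    exact hP0 (by rw [eq_C_of_natDegree_eq_zero h, this, C_0])
  have hne : derivative P ≠ 0 := fun h => hdeg (derivative_eq_zero.mp h)
  exact Nat.find_min hex (hPd ▸ natDegree_derivative_lt hdeg) ⟨_, hne, hd, rfl⟩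

/-- The fraction field of `A` is a finite separable extension of that of `R`. Here `θ` is a
primitive element multiplied into `A`, and `P` its minimal polynomial multiplied into `R[X]`. The
last two clauses are generation by `θ` and divisibility by the minimal polynomial, up to
denominators from `R`. -/
theorem exists_primitive [Algebra.IsAlgebraic R A] [Algebra.FiniteType R A] :
    ∃ (θ : A) (P : R[X]), aeval θ P = 0 ∧ aeval θ (derivative P) ≠ 0 ∧
      (∀ a : A, ∃ r : R, r ≠ 0 ∧ ∃ Q : R[X], algebraMap R A r * a = aeval θ Q) ∧
      ∀ Q : R[X], aeval θ Q = 0 → ∃ r : R, r ≠ 0 ∧ ∃ T : R[X], C r * Q = P * T := by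
  let F := FractionRing R
  let K := FractionRing A
  let _ : Algebra F K := FractionRing.liftAlgebra R K
  have : IsScalarTower R F K := FractionRing.isScalarTower_liftAlgebra R K
  have hRF : Function.Injective (algebraMap R F) := IsFractionRing.injective R F
  have hAK : Function.Injective (algebraMap A K) := IsFractionRing.injective A K
  have : Algebra.IsAlgebraic A K := IsFractionRing.comap_isAlgebraic_iff.mpr
    (inferInstance : Algebra.IsAlgebraic K K)
  have : Algebra.IsAlgebraic R K := Algebra.IsAlgebraic.trans R A K
  have : Algebra.IsAlgebraic F K := IsFractionRing.comap_isAlgebraic_iff.mp this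
  have : Algebra.EssFiniteType A K := Algebra.EssFiniteType.of_isLocalization K (nonZeroDivisors A)
  have : Algebra.EssFiniteType R K := Algebra.EssFiniteType.comp R A K
  have : Algebra.EssFiniteType F K := Algebra.EssFiniteType.of_comp R F K
  have : FiniteDimensional F K := Algebra.finite_of_essFiniteType_of_isAlgebraic
  have : CharZero F := charZero_of_injective_algebraMap hRF
  obtain ⟨θ', hθ'⟩ := Field.exists_primitive_element F K
  -- As `A` is algebraic over `R`, its fraction field is already obtained by inverting the nonzero
  -- elements of `R`, so the denominator can be taken there.
  obtain ⟨⟨θ, ⟨_, r₁, hr₁, rfl⟩⟩, hθ⟩ :=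
    IsLocalization.surj (Algebra.algebraMapSubmonoid A (nonZeroDivisors R)) θ'
  simp only at hθ
  have hr₁' : algebraMap R F r₁ ≠ 0 := fun h =>
    nonZeroDivisors.ne_zero hr₁ (hRF (h.trans (map_zero _).symm))
  set x : K := algebraMap A K θ with hx
  have htop : IntermediateField.adjoin F {x} = ⊤ := by
    rw [eq_top_iff, ← hθ', IntermediateField.adjoin_simple_le_iff]
    have h1 : θ' = (algebraMap R F r₁)⁻¹ • x := by
      rw [← hθ, ← IsScalarTower.algebraMap_apply R A K, IsScalarTower.algebraMap_apply R F K,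
        mul_comm, ← Algebra.smul_def, smul_smul, inv_mul_cancel₀ hr₁', one_smul]
    rw [h1]
    exact IntermediateField.smul_mem _ (IntermediateField.mem_adjoin_simple_self F x)
  have hrep : ∀ y : K, ∃ q : F[X], aeval x q = y := by
    intro y
    have h1 : y ∈ (IntermediateField.adjoin F {x}).toSubalgebra := by rw [htop]; trivial
    rw [IntermediateField.adjoin_simple_toSubalgebra_of_isAlgebraic
      (Algebra.IsAlgebraic.isAlgebraic x), Algebra.adjoin_singleton_eq_range_aeval] at h1
    exact h1
  have hmap : ∀ Q : R[X], aeval x (Q.map (algebraMap R F)) = algebraMap A K (aeval θ Q) := by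
    intro Q
    rw [aeval_map_algebraMap, hx, aeval_algebraMap_apply]
  obtain ⟨r₀, hr₀, P, hP⟩ := exists_map_eq_smul (minpoly F x)
  have hr₀' : algebraMap R F r₀ ≠ 0 := fun h => hr₀ (hRF (h.trans (map_zero _).symm))
  have hsmul : ∀ (r : R) (q : F[X]), r • q = C (algebraMap R F r) * q := by
    intro r q
    rw [← smul_eq_C_mul, algebraMap_smul]
  rw [hsmul] at hP
  refine ⟨θ, P, hAK ?_, fun h => ?_, fun a => ?_, fun Q hQ => ?_⟩
  · rw [← hmap, hP, map_mul, minpoly.aeval, mul_zero, map_zero]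
  · have h1 := hmap (derivative P)
    rw [h, map_zero, ← derivative_map, hP, derivative_C_mul, map_mul, aeval_C] at h1
    have h2 : aeval x (derivative (minpoly F x)) ≠ 0 :=
      (Algebra.IsSeparable.isSeparable F x).aeval_derivative_ne_zero (minpoly.aeval F x)
    refine mul_ne_zero ?_ h2 h1
    simpa using hr₀'
  · obtain ⟨q, hq⟩ := hrep (algebraMap A K a)
    obtain ⟨r, hr, Q, hQ⟩ := exists_map_eq_smul q
    refine ⟨r, hr, Q, hAK ?_⟩
    rw [← hmap, hQ, hsmul, map_mul (aeval x), hq, aeval_C, map_mul,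
      ← IsScalarTower.algebraMap_apply R A K,
      IsScalarTower.algebraMap_apply R F K]
  · have h1 := hmap Q
    rw [hQ, map_zero] at h1
    obtain ⟨t, ht⟩ := minpoly.dvd F x h1
    -- Since `P` is `r₀` times the minimal polynomial, the cofactor is divided by `r₀` before
    -- clearing denominators.
    obtain ⟨r, hr, T, hT⟩ := exists_map_eq_smul (C (algebraMap R F r₀)⁻¹ * t)
    rw [hsmul] at hT
    refine ⟨r, hr, T, map_injective _ hRF ?_⟩
    rw [Polynomial.map_mul, Polynomial.map_mul, map_C, hT, hP, ht]
    have : C (algebraMap R F r₀) * C (algebraMap R F r₀)⁻¹ = (1 : F[X]) := by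
      rw [← C_mul, mul_inv_cancel₀ hr₀', C_1]
    linear_combination (-(C (algebraMap R F r) * minpoly F x * t)) * this

end Separable

/-! ### Irreducible subsets of vector spaces. -/

section Irreducible

variable {W W' : Type*} [AddCommGroup W] [Module ℂ W] [AddCommGroup W'] [Module ℂ W']

/-- Non-empty sets with a prime ideal of vanishing polynomial functions. -/
def IsIrreducibleSet (Z : Set W) : Prop :=
  Z.Nonempty ∧ ∀ f ∈ polyFun W, ∀ g ∈ polyFun W, (∀ z ∈ Z, f z * g z = 0) →
    (∀ z ∈ Z, f z = 0) ∨ ∀ z ∈ Z, g z = 0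

theorem IsIrreducibleSet.isDomain {Z : Set W} (hZ : IsIrreducibleSet Z) :
    IsDomain (coordinateRing Z) := by
  obtain ⟨z₀, hz₀⟩ := hZ.1
  have : Nontrivial (coordinateRing Z) := ⟨0, 1, fun h => by
    have := congrArg (fun g : coordinateRing Z => g.1 ⟨z₀, hz₀⟩) h
    simp at this⟩
  have : NoZeroDivisors (coordinateRing Z) := ⟨fun {a b} hab => by
    obtain ⟨⟨f, hf⟩, rfl⟩ := restrictHom_surjective Z a
    obtain ⟨⟨g, hg⟩, rfl⟩ := restrictHom_surjective Z b
    have h := fun z (hz : z ∈ Z) => congrArg (fun g : coordinateRing Z => g.1 ⟨z, hz⟩) hab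
    rcases hZ.2 f hf g hg h with h | h
    · exact Or.inl (Subtype.ext (funext fun z => h z z.2))
    · exact Or.inr (Subtype.ext (funext fun z => h z z.2))⟩
  exact NoZeroDivisors.to_isDomain _

/-- Non-vanishing conditions on an irreducible set can be met simultaneously. -/
theorem IsIrreducibleSet.exists_mul_ne_zero {Z : Set W} (hZ : IsIrreducibleSet Z) {f g : W → ℂ}
    (hf : f ∈ polyFun W) (hg : g ∈ polyFun W) (hf0 : ∃ z ∈ Z, f z ≠ 0) (hg0 : ∃ z ∈ Z, g z ≠ 0) :
    ∃ z ∈ Z, f z * g z ≠ 0 := by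
  by_contra! h
  obtain ⟨z, hz, hfz⟩ := hf0
  obtain ⟨z', hz', hgz'⟩ := hg0
  rcases hZ.2 f hf g hg h with h | h
  · exact hfz (h z hz)
  · exact hgz' (h z' hz')

/-- A polynomial function vanishing wherever `q` does not vanish vanishes everywhere. -/
theorem IsIrreducibleSet.eq_zero_of_generic {Z : Set W} (hZ : IsIrreducibleSet Z) {q f : W → ℂ}
    (hq : q ∈ polyFun W) (hf : f ∈ polyFun W) (hq0 : ∃ z ∈ Z, q z ≠ 0)
    (h : ∀ z ∈ Z, q z ≠ 0 → f z = 0) : ∀ z ∈ Z, f z = 0 := by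
  refine (hZ.2 q hq f hf fun z hz => ?_).resolve_left fun h' => ?_
  · by_cases hqz : q z = 0
    · rw [hqz, zero_mul]
    · rw [h z hz hqz, mul_zero]
  · obtain ⟨z, hz, hqz⟩ := hq0
    exact hqz (h' z hz)

theorem IsIrreducibleSet.exists_prod_ne_zero {Z : Set W} (hZ : IsIrreducibleSet Z) {ι : Type*}
    (s : Finset ι) {f : ι → W → ℂ} (hf : ∀ i ∈ s, f i ∈ polyFun W)
    (hf0 : ∀ i ∈ s, ∃ z ∈ Z, f i z ≠ 0) : ∃ z ∈ Z, ∏ i ∈ s, f i z ≠ 0 := by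
  classical
  induction s using Finset.induction_on with
  | empty => exact ⟨hZ.1.some, hZ.1.some_mem, by simp⟩
  | insert a s ha ih =>
    have h := hZ.exists_mul_ne_zero (hf a (Finset.mem_insert_self a s)) (g := ∏ i ∈ s, f i)
      (prod_mem fun i hi => hf i (Finset.mem_insert_of_mem hi))
      (hf0 a (Finset.mem_insert_self a s)) (by
        simpa using ih (fun i hi => hf i (Finset.mem_insert_of_mem hi))
          (fun i hi => hf0 i (Finset.mem_insert_of_mem hi)))
    simpa [Finset.prod_insert ha] using h

theorem isIrreducibleSet_univ [FiniteDimensional ℂ W] : IsIrreducibleSet (Set.univ : Set W) := by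
  refine ⟨⟨0, trivial⟩, fun f hf g hg h => ?_⟩
  let b := Module.finBasis ℂ W
  obtain ⟨p, hp⟩ := exists_mvPolynomial_of_mem_polyFun b hf
  obtain ⟨q, hq⟩ := exists_mvPolynomial_of_mem_polyFun b hg
  have h0 : p * q = 0 := by
    apply MvPolynomial.funext
    intro x
    have := h (b.equivFun.symm x) trivial
    have hrep : (fun i => b.coord i (b.equivFun.symm x)) = x := by
      ext i
      rw [b.coord_apply, ← b.equivFun_apply, LinearEquiv.apply_symm_apply]
    rw [hp, hq, hrep] at this
    simpa using this
  rcases mul_eq_zero.mp h0 with h | h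
  · left; intro z _; simp [hp, h]
  · right; intro z _; simp [hq, h]

/-- If neither factor vanishes identically, irreducibility of `W'` gives one `a` for which both
restrict to nonzero functions on the slice `Z × {a}`; there irreducibility of `Z` applies. -/
theorem IsIrreducibleSet.prod_univ [FiniteDimensional ℂ W'] {Z : Set W} (hZ : IsIrreducibleSet Z) :
    IsIrreducibleSet (Z ×ˢ (Set.univ : Set W')) := by
  refine ⟨⟨(hZ.1.some, 0), hZ.1.some_mem, trivial⟩, fun f hf g hg h => ?_⟩
  have hfix : ∀ {f : W × W' → ℂ}, f ∈ polyFun (W × W') → ∀ c, (fun w => f (w, c)) ∈ polyFun W := by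
    intro f hf c
    induction hf using polyFun_induction with
    | linear φ =>
      convert add_mem (linear_mem_polyFun (φ ∘ₗ LinearMap.inl ℂ W W'))
        (const_mem_polyFun (φ (0, c))) using 1
      ext w
      simp [← map_add]
    | const a => exact const_mem_polyFun a
    | add f g _ _ h1 h2 => exact add_mem h1 h2
    | mul f g _ _ h1 h2 => exact mul_mem h1 h2
  have hfix' : ∀ {f : W × W' → ℂ}, f ∈ polyFun (W × W') → ∀ w, (fun c => f (w, c)) ∈ polyFun W' := by
    intro f hf w
    induction hf using polyFun_induction with
    | linear φ =>
      convert add_mem (linear_mem_polyFun (φ ∘ₗ LinearMap.inr ℂ W W'))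
        (const_mem_polyFun (φ (w, 0))) using 1
      ext c
      simp [← map_add]
    | const a => exact const_mem_polyFun a
    | add f g _ _ h1 h2 => exact add_mem h1 h2
    | mul f g _ _ h1 h2 => exact mul_mem h1 h2
  by_contra! hcon
  obtain ⟨⟨⟨z, c⟩, hz, hfz⟩, ⟨⟨z', c'⟩, hz', hgz'⟩⟩ := hcon
  obtain ⟨a, -, ha⟩ := isIrreducibleSet_univ.exists_mul_ne_zero (hfix' hf z) (hfix' hg z')
    ⟨c, trivial, hfz⟩ ⟨c', trivial, hgz'⟩
  rcases hZ.2 _ (hfix hf a) _ (hfix hg a) (fun w hw => h (w, a) ⟨hw, trivial⟩) with h | h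
  · exact left_ne_zero_of_mul ha (h z hz.1)
  · exact right_ne_zero_of_mul ha (h z' hz'.1)

end Irreducible

/-! ### Cones and the Zariski topology on projective space. -/

section Cone

variable {W : Type*} [AddCommGroup W] [Module ℂ W]

theorem zero_mem_cone (Y : Set (ℙ ℂ W)) : (0 : W) ∈ cone Y := fun h => (h rfl).elim

theorem smul_mem_cone {Y : Set (ℙ ℂ W)} {w : W} (hw : w ∈ cone Y) (c : ℂ) : c • w ∈ cone Y := by
  intro hcw
  have hw0 : w ≠ 0 := fun h => hcw (by rw [h, smul_zero])
  have hc : c ≠ 0 := fun h => hcw (by rw [h, zero_smul])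
  have : Projectivization.mk ℂ (c • w) hcw = Projectivization.mk ℂ w hw0 :=
    (Projectivization.mk_eq_mk_iff' ℂ _ _ _ _).mpr ⟨c, rfl⟩
  rw [this]
  exact hw hw0

theorem rep_mem_cone {Y : Set (ℙ ℂ W)} {p : ℙ ℂ W} (hp : p ∈ Y) : p.rep ∈ cone Y := by
  intro h
  rwa [Projectivization.mk_rep]

theorem IsForm.mem_zeroLocus_mk_iff {d : ℕ} {f : W → ℂ} (hf : IsForm d f) {w : W} (hw : w ≠ 0) :
    Projectivization.mk ℂ w hw ∈ zeroLocus f ↔ f w = 0 := by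
  constructor
  · intro h
    exact h w (by rw [Projectivization.submodule_mk]; exact Submodule.mem_span_singleton_self w)
  · intro h v hv
    rw [Projectivization.submodule_mk, Submodule.mem_span_singleton] at hv
    obtain ⟨c, rfl⟩ := hv
    rw [hf.2, h, mul_zero]

theorem IsForm.mem_zeroLocus_iff {d : ℕ} {f : W → ℂ} (hf : IsForm d f) (p : ℙ ℂ W) :
    p ∈ zeroLocus f ↔ f p.rep = 0 := by
  rw [← hf.mem_zeroLocus_mk_iff p.rep_nonzero, Projectivization.mk_rep]

theorem IsForm.mul {d e : ℕ} {f g : W → ℂ} (hf : IsForm d f) (hg : IsForm e g) :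
    IsForm (d + e) (f * g) :=
  ⟨mul_mem hf.1 hg.1, fun c w => by simp only [Pi.mul_apply, hf.2, hg.2]; ring⟩

theorem isTopologicalBasis_zeroLocus_compl (W : Type*) [AddCommGroup W] [Module ℂ W] :
    @TopologicalSpace.IsTopologicalBasis (ℙ ℂ W) (zariskiTopology W)
      {O | ∃ (d : ℕ) (f : W → ℂ), IsForm d f ∧ O = (zeroLocus f)ᶜ} := by
  let _ := zariskiTopology W
  refine ⟨?_, ?_, rfl⟩
  · rintro _ ⟨d, f, hf, rfl⟩ _ ⟨e, g, hg, rfl⟩ x ⟨hx1, hx2⟩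
    refine ⟨_, ⟨_, _, hf.mul hg, rfl⟩, ?_, ?_⟩
    · rw [Set.mem_compl_iff, hf.mem_zeroLocus_iff] at hx1
      rw [Set.mem_compl_iff, hg.mem_zeroLocus_iff] at hx2
      rw [Set.mem_compl_iff, (hf.mul hg).mem_zeroLocus_iff]
      exact mul_ne_zero hx1 hx2
    · intro y hy
      rw [Set.mem_compl_iff, (hf.mul hg).mem_zeroLocus_iff] at hy
      rw [Set.mem_inter_iff, Set.mem_compl_iff, hf.mem_zeroLocus_iff, Set.mem_compl_iff,
        hg.mem_zeroLocus_iff]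
      exact ⟨left_ne_zero_of_mul hy, right_ne_zero_of_mul hy⟩
  · rw [Set.eq_univ_iff_forall]
    intro x
    have h1 : IsForm 0 (fun _ : W => (1 : ℂ)) := ⟨const_mem_polyFun 1, by simp⟩
    refine ⟨_, ⟨0, _, h1, rfl⟩, ?_⟩
    rw [Set.mem_compl_iff, h1.mem_zeroLocus_iff]
    exact one_ne_zero

theorem mem_closure_zariski_iff {Y : Set (ℙ ℂ W)} {p : ℙ ℂ W} :
    p ∈ closure[zariskiTopology W] Y ↔
      ∀ (d : ℕ) (f : W → ℂ), IsForm d f → (∀ w ∈ cone Y, f w = 0) → f p.rep = 0 := by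
  let _ := zariskiTopology W
  rw [(isTopologicalBasis_zeroLocus_compl W).mem_closure_iff]
  constructor
  · intro h d f hf hfY
    by_contra hp
    obtain ⟨q, hq, hqY⟩ := h _ ⟨d, f, hf, rfl⟩ (by
      rwa [Set.mem_compl_iff, hf.mem_zeroLocus_iff])
    rw [Set.mem_compl_iff, hf.mem_zeroLocus_iff] at hq
    exact hq (hfY _ (rep_mem_cone hqY))
  · rintro h _ ⟨d, f, hf, rfl⟩ hp
    rw [Set.mem_compl_iff, hf.mem_zeroLocus_iff] at hp
    by_contra hne
    have hY : ∀ q ∈ Y, f q.rep = 0 := by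
      intro q hq
      by_contra hfq
      exact hne ⟨q, by rwa [Set.mem_compl_iff, hf.mem_zeroLocus_iff], hq⟩
    have hW : ∀ w ∈ cone Y, w ≠ 0 → f w = 0 := fun w hw hw0 => by
      have := hY _ (hw hw0)
      rwa [← hf.mem_zeroLocus_iff, hf.mem_zeroLocus_mk_iff] at this
    -- multiply by a linear form so that the value at the origin is zero
    obtain ⟨φ, hφ⟩ : ∃ φ : Module.Dual ℂ W, φ p.rep ≠ 0 := by
      by_contra! h0
      exact p.rep_nonzero ((Module.forall_dual_apply_eq_zero_iff ℂ _).mp h0)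
    have hφf : IsForm 1 (fun w => φ w) := ⟨linear_mem_polyFun φ, by simp⟩
    refine mul_ne_zero hp hφ (h _ _ (hf.mul hφf) fun w hw => ?_)
    by_cases hw0 : w = 0
    · simp [hw0]
    · simp [hW w hw hw0]

theorem eq_zero_of_sum_pow_mul_eq_zero {D : ℕ} {a : ℕ → ℂ}
    (h : ∀ c : ℂ, ∑ d ∈ Finset.range D, c ^ d * a d = 0) : ∀ d < D, a d = 0 := by
  have h0 : (∑ d ∈ Finset.range D, Polynomial.monomial d (a d)) = 0 := by
    apply Polynomial.funext
    intro c
    simpa [Polynomial.eval_finsetSum, mul_comm] using h c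
  intro d hd
  have := congrArg (fun p => Polynomial.coeff p d) h0
  simpa [Polynomial.finsetSum_coeff, Polynomial.coeff_monomial, hd] using this

variable [FiniteDimensional ℂ W]

/-- A polynomial function not vanishing at `v` has a homogeneous component that does not vanish at
`v`, but vanishes on every cone on which the function vanishes. -/
theorem exists_form_ne_zero {f : W → ℂ} (hf : f ∈ polyFun W) {v : W} (hv : f v ≠ 0) :
    ∃ (d : ℕ) (g : W → ℂ), IsForm d g ∧ g v ≠ 0 ∧
      ∀ w, (∀ c : ℂ, f (c • w) = 0) → g w = 0 := by
  obtain ⟨D, g, hg, hfg⟩ := exists_forms_of_mem_polyFun hf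
  have : ∃ d ∈ Finset.range D, g d v ≠ 0 := by
    by_contra! h
    apply hv
    have := hfg 1 v
    rw [one_smul] at this
    rw [this]
    exact Finset.sum_eq_zero fun d hd => by rw [h d hd, mul_zero]
  obtain ⟨d, hd, hdv⟩ := this
  refine ⟨d, g d, hg d, hdv, fun w hw => ?_⟩
  exact eq_zero_of_sum_pow_mul_eq_zero (a := fun d => g d w)
    (fun c => by rw [← hfg, hw]) d (Finset.mem_range.mp hd)

/-- The closure is tested only by forms. As the cone is stable under scaling, the homogeneous
components of a function vanishing on it vanish on it too. -/
theorem eq_zero_on_cone_closure {Y : Set (ℙ ℂ W)} {g : W → ℂ} (hg : g ∈ polyFun W)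
    (h : ∀ w ∈ cone Y, g w = 0) : ∀ w ∈ cone (closure[zariskiTopology W] Y), g w = 0 := by
  intro w hw
  by_contra hgw
  by_cases hw0 : w = 0
  · rw [hw0] at hgw
    exact hgw (h 0 (zero_mem_cone Y))
  obtain ⟨d, f, hf, hfw, hfY⟩ := exists_form_ne_zero hg hgw
  have := mem_closure_zariski_iff.mp (hw hw0) d f hf fun v hv =>
    hfY v fun c => h _ (smul_mem_cone hv c)
  rw [← hf.mem_zeroLocus_iff, hf.mem_zeroLocus_mk_iff] at this
  exact hfw this

omit [FiniteDimensional ℂ W] in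
theorem subset_cone_closure (Y : Set (ℙ ℂ W)) : cone Y ⊆ cone (closure[zariskiTopology W] Y) :=
  fun _ hw hw0 => by
    let _ := zariskiTopology W
    exact subset_closure (hw hw0)

omit [FiniteDimensional ℂ W] in
theorem exists_ne_zero_of_notMem_cone {X : Set (ℙ ℂ W)} (hX : IsClosed[zariskiTopology W] X) {v : W}
    (hv : v ∉ cone X) : ∃ f ∈ polyFun W, (∀ w ∈ cone X, f w = 0) ∧ f v ≠ 0 := by
  have hv' : ∃ hv0 : v ≠ 0, Projectivization.mk ℂ v hv0 ∉ X := by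
    by_contra! h
    exact hv h
  obtain ⟨hv0, hvX⟩ := hv'
  rw [← @IsClosed.closure_eq _ (zariskiTopology W) _ hX, mem_closure_zariski_iff] at hvX
  push Not at hvX
  obtain ⟨d, f, hf, hfX, hfv⟩ := hvX
  refine ⟨f, hf.1, hfX, ?_⟩
  rwa [Ne, ← hf.mem_zeroLocus_mk_iff hv0, hf.mem_zeroLocus_iff]

/-- Topological irreducibility only handles forms, so each function is replaced by a homogeneous
component that does not vanish on all of `X`. At a common nonvanishing point both functions are
nonzero somewhere on the corresponding line, and the line itself is irreducible. -/
theorem IsProjectiveVariety.isIrreducibleSet_cone {X : Set (ℙ ℂ W)} (hX : IsProjectiveVariety X) :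
    IsIrreducibleSet (cone X) := by
  refine ⟨⟨0, zero_mem_cone X⟩, fun f hf g hg h => ?_⟩
  by_contra! hcon
  have key : ∀ {f : W → ℂ}, f ∈ polyFun W → (∃ z ∈ cone X, f z ≠ 0) →
      ∃ (d : ℕ) (f₁ : W → ℂ), IsForm d f₁ ∧ (X ∩ (zeroLocus f₁)ᶜ).Nonempty ∧
        ∀ w, f₁ w ≠ 0 → ∃ c : ℂ, f (c • w) ≠ 0 := by
    rintro f hf ⟨v, hv, hfv⟩
    obtain ⟨d, f₁, hf₁, hv₁, hf₁f⟩ := exists_form_ne_zero hf hfv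
    refine ⟨d, f₁, hf₁, ?_, fun w hw => by
      by_contra! h
      exact hw (hf₁f w h)⟩
    -- A form that is nonzero at the vertex is nonzero everywhere, by homogeneity with scalar `0`;
    -- any point of `X` then serves.
    by_cases hv0 : v = 0
    · obtain ⟨p, hp⟩ := hX.2.1
      refine ⟨p, hp, ?_⟩
      rw [Set.mem_compl_iff, hf₁.mem_zeroLocus_iff]
      have := hf₁.2 0 p.rep
      rw [zero_smul, ← hv0] at this
      exact right_ne_zero_of_mul (this ▸ hv₁)
    · refine ⟨_, hv hv0, ?_⟩
      rwa [Set.mem_compl_iff, hf₁.mem_zeroLocus_mk_iff]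
  obtain ⟨d, f₁, hf₁, hf₁X, hff⟩ := key hf hcon.1
  obtain ⟨e, g₁, hg₁, hg₁X, hgg⟩ := key hg hcon.2
  obtain ⟨p, hpX, hpf, hpg⟩ := hX.2.2 _ _
    (TopologicalSpace.isOpen_generateFrom_of_mem ⟨d, f₁, hf₁, rfl⟩)
    (TopologicalSpace.isOpen_generateFrom_of_mem ⟨e, g₁, hg₁, rfl⟩) hf₁X hg₁X
  rw [Set.mem_compl_iff, hf₁.mem_zeroLocus_iff] at hpf
  rw [Set.mem_compl_iff, hg₁.mem_zeroLocus_iff] at hpg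
  obtain ⟨c, hc⟩ := hff _ hpf
  obtain ⟨c', hc'⟩ := hgg _ hpg
  obtain ⟨a, -, ha⟩ := isIrreducibleSet_univ.exists_mul_ne_zero
    (polyFun_comp_linear hf (LinearMap.toSpanSingleton ℂ W p.rep))
    (polyFun_comp_linear hg (LinearMap.toSpanSingleton ℂ W p.rep))
    ⟨c, trivial, by simpa using hc⟩ ⟨c', trivial, by simpa using hc'⟩
  exact ha (h _ (by simpa using smul_mem_cone (rep_mem_cone hpX) a))

end Cone

/-! ### Algebraic relations over a transcendence basis, and their evaluation at points. -/

section Relations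

open Polynomial

variable {σ A : Type*} [CommRing A] [IsDomain A] [Algebra ℂ A]

-- This moves algebraicity from the subalgebra generated by `y` to the polynomial ring isomorphic to
-- it, whose elements can be evaluated at points.
omit [IsDomain A] in
theorem isAlgebraic_of_isTranscendenceBasis {y : σ → A} (hy : IsTranscendenceBasis ℂ y) :
    letI := (MvPolynomial.aeval (R := ℂ) y).toRingHom.toAlgebra
    FaithfulSMul (MvPolynomial σ ℂ) A ∧ Algebra.IsAlgebraic (MvPolynomial σ ℂ) A ∧
      IsScalarTower ℂ (MvPolynomial σ ℂ) A := by
  let _ := (MvPolynomial.aeval (R := ℂ) y).toRingHom.toAlgebra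
  have hf : FaithfulSMul (MvPolynomial σ ℂ) A :=
    (faithfulSMul_iff_algebraMap_injective _ _).mpr hy.1
  have : IsScalarTower ℂ (MvPolynomial σ ℂ) A :=
    IsScalarTower.of_algebraMap_eq fun x => ((MvPolynomial.aeval y).commutes x).symm
  refine ⟨hf, ?_, this⟩
  have h := hy.isAlgebraic
  rw [Algebra.adjoin_range_eq_range_aeval] at h
  constructor
  intro a
  obtain ⟨p, hp0, hp⟩ := h.isAlgebraic a
  let e := AlgEquiv.ofInjective (MvPolynomial.aeval (R := ℂ) y) hy.1
  refine ⟨p.map e.symm.toRingEquiv.toRingHom, ?_, ?_⟩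
  · rwa [Ne, Polynomial.map_eq_zero_iff e.symm.injective]
  · rw [aeval_def, eval₂_map, ← hp, aeval_def]
    congr 1
    ext x
    have : (MvPolynomial.aeval y (e.symm x) : A) = x :=
      congrArg Subtype.val (e.apply_symm_apply x)
    exact this

omit [IsDomain A] in
theorem exists_relation {y : σ → A} (hy : IsTranscendenceBasis ℂ y) (a : A) :
    ∃ P : (MvPolynomial σ ℂ)[X], P.eval₂ (MvPolynomial.aeval (R := ℂ) y).toRingHom a = 0 ∧
      (derivative P).eval₂ (MvPolynomial.aeval (R := ℂ) y).toRingHom a ≠ 0 := by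
  let _ := (MvPolynomial.aeval (R := ℂ) y).toRingHom.toAlgebra
  obtain ⟨h1, h2, -⟩ := isAlgebraic_of_isTranscendenceBasis hy
  exact exists_separable_relation a

theorem exists_primitive_relation {y : σ → A} (hy : IsTranscendenceBasis ℂ y)
    [Algebra.FiniteType ℂ A] :
    ∃ (θ : A) (P : (MvPolynomial σ ℂ)[X]),
      P.eval₂ (MvPolynomial.aeval (R := ℂ) y).toRingHom θ = 0 ∧
      (derivative P).eval₂ (MvPolynomial.aeval (R := ℂ) y).toRingHom θ ≠ 0 ∧
      (∀ a : A, ∃ r : MvPolynomial σ ℂ, r ≠ 0 ∧ ∃ Q : (MvPolynomial σ ℂ)[X],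
        MvPolynomial.aeval y r * a = Q.eval₂ (MvPolynomial.aeval (R := ℂ) y).toRingHom θ) ∧
      ∀ Q : (MvPolynomial σ ℂ)[X], Q.eval₂ (MvPolynomial.aeval (R := ℂ) y).toRingHom θ = 0 →
        ∃ r : MvPolynomial σ ℂ, r ≠ 0 ∧ ∃ T : (MvPolynomial σ ℂ)[X], C r * Q = P * T := by
  let _ := (MvPolynomial.aeval (R := ℂ) y).toRingHom.toAlgebra
  obtain ⟨h1, h2, h3⟩ := isAlgebraic_of_isTranscendenceBasis hy
  have := Algebra.FiniteType.of_restrictScalars_finiteType ℂ (MvPolynomial σ ℂ) A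
  exact exists_primitive

end Relations

section Evaluation

open Polynomial

variable {W : Type*} [AddCommGroup W] [Module ℂ W] {σ : Type*}

theorem coordinateRing_eval₂_apply {Z : Set W} {y : σ → coordinateRing Z}
    (P : (MvPolynomial σ ℂ)[X]) (a : coordinateRing Z) (z : Z) :
    (P.eval₂ (MvPolynomial.aeval (R := ℂ) y).toRingHom a).1 z
      = P.eval₂ (MvPolynomial.eval fun i => (y i).1 z) (a.1 z) := by
  induction P using Polynomial.induction_on' with
  | add p q hp hq =>
    rw [eval₂_add, eval₂_add, ← hp, ← hq]; rfl
  | monomial n r =>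
    rw [eval₂_monomial, eval₂_monomial, ← coordinateRing_aeval_apply]; rfl

theorem eval₂_mem_polyFun {y : σ → W → ℂ} (hy : ∀ i, y i ∈ polyFun W) {x : W → ℂ}
    (hx : x ∈ polyFun W) (P : (MvPolynomial σ ℂ)[X]) :
    (fun w => P.eval₂ (MvPolynomial.eval fun i => y i w) (x w)) ∈ polyFun W := by
  induction P using Polynomial.induction_on' with
  | add p q hp hq =>
    simp only [eval₂_add]; exact add_mem hp hq
  | monomial n r =>
    simp only [eval₂_monomial]; exact mul_mem (aeval_mem_polyFun hy r) (pow_mem hx n)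

end Evaluation

/-! ### Tangent spaces and the Jacobian criterion at general points. -/

section Jacobian

open Polynomial

variable {W : Type*} [NormedAddCommGroup W] [NormedSpace ℂ W] [FiniteDimensional ℂ W] {σ : Type*}

theorem fderiv_eval_eq_zero {y : σ → W → ℂ} (hy : ∀ i, y i ∈ polyFun W) {w δ : W}
    (hδ : ∀ i, fderiv ℂ (y i) w δ = 0) (p : MvPolynomial σ ℂ) :
    fderiv ℂ (fun w => MvPolynomial.eval (fun i => y i w) p) w δ = 0 := by
  induction p using MvPolynomial.induction_on with
  | C a => simp
  | add p q hp hq =>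
    simp only [map_add]
    rw [fderiv_fun_add (differentiableAt_of_mem_polyFun (aeval_mem_polyFun hy p) w)
      (differentiableAt_of_mem_polyFun (aeval_mem_polyFun hy q) w)]
    simp [hp, hq]
  | mul_X p i hp =>
    simp only [map_mul, MvPolynomial.eval_X]
    rw [fderiv_fun_mul (differentiableAt_of_mem_polyFun (aeval_mem_polyFun hy p) w)
      (differentiableAt_of_mem_polyFun (hy i) w)]
    simp [hp, hδ]

/-- By the chain rule: the coefficients are stationary in the direction `δ`, so only the variable of
`P` contributes. -/
theorem fderiv_eval₂_eq {y : σ → W → ℂ} (hy : ∀ i, y i ∈ polyFun W) {x : W → ℂ}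
    (hx : x ∈ polyFun W) {w δ : W} (hδ : ∀ i, fderiv ℂ (y i) w δ = 0)
    (P : (MvPolynomial σ ℂ)[X]) :
    fderiv ℂ (fun w => P.eval₂ (MvPolynomial.eval fun i => y i w) (x w)) w δ
      = (derivative P).eval₂ (MvPolynomial.eval fun i => y i w) (x w) * fderiv ℂ x w δ := by
  induction P using Polynomial.induction_on' with
  | add p q hp hq =>
    simp only [eval₂_add, derivative_add, add_mul]
    rw [fderiv_fun_add (differentiableAt_of_mem_polyFun (eval₂_mem_polyFun hy hx p) w)
      (differentiableAt_of_mem_polyFun (eval₂_mem_polyFun hy hx q) w)]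
    simp [hp, hq]
  | monomial n r =>
    simp only [eval₂_monomial, derivative_monomial]
    have hxd := differentiableAt_of_mem_polyFun hx w
    rw [fderiv_fun_mul (differentiableAt_of_mem_polyFun (aeval_mem_polyFun hy r) w)
      (hxd.fun_pow n), fderiv_fun_pow n hxd]
    simp [fderiv_eval_eq_zero hy hδ r]
    ring

/-- The vectors at `z` annihilated by the differentials of the polynomial functions that vanish
on `Z`. -/
noncomputable def tangentSpaceAt (Z : Set W) (z : W) : Submodule ℂ W :=
  ⨅ f ∈ {f : W → ℂ | f ∈ polyFun W ∧ ∀ w ∈ Z, f w = 0}, LinearMap.ker (fderiv ℂ f z).toLinearMap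

omit [FiniteDimensional ℂ W] in
theorem mem_tangentSpaceAt {Z : Set W} {z δ : W} :
    δ ∈ tangentSpaceAt Z z ↔ ∀ f ∈ polyFun W, (∀ w ∈ Z, f w = 0) → fderiv ℂ f z δ = 0 := by
  simp [tangentSpaceAt, Submodule.mem_iInf]

/-- At a general point, the differentials of a transcendence basis separate tangent vectors. -/
theorem exists_generic_separating {Z : Set W} (hZ : IsIrreducibleSet Z) {y : σ → polyFun W}
    (hy : IsTranscendenceBasis ℂ fun i => restrictHom Z (y i)) :
    ∃ q ∈ polyFun W, (∃ z ∈ Z, q z ≠ 0) ∧ ∀ z ∈ Z, q z ≠ 0 → ∀ δ ∈ tangentSpaceAt Z z,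
      (∀ i, fderiv ℂ (y i : W → ℂ) z δ = 0) → δ = 0 := by
  have := hZ.isDomain
  let b := Module.finBasis ℂ W
  have hb : ∀ j, (fun w => b.coord j w) ∈ polyFun W := fun j => linear_mem_polyFun _
  -- Each coordinate satisfies a separable relation over `y`. Differentiating it along a tangent
  -- vector killed by all `dy i` leaves `P' * db_j(δ) = 0`, so the product of the `P'` serves as
  -- `q`.
  choose P hP0 hP1 using fun j => exists_relation hy (restrictHom Z ⟨_, hb j⟩)
  have hmem : ∀ j, (fun w => (derivative (P j)).eval₂
      (MvPolynomial.eval fun i => (y i : W → ℂ) w) (b.coord j w)) ∈ polyFun W :=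
    fun j => eval₂_mem_polyFun (fun i => (y i).2) (hb j) _
  refine ⟨_, prod_mem fun j (_ : j ∈ Finset.univ) => hmem j, ?_, fun z hz hq δ hδ hyδ => ?_⟩
  · have := hZ.exists_prod_ne_zero Finset.univ (fun j _ => hmem j) fun j _ => by
      by_contra! h
      refine hP1 j (Subtype.ext (funext fun z => ?_))
      rw [coordinateRing_eval₂_apply]
      exact h z z.2
    simpa using this
  · rw [Finset.prod_apply, Finset.prod_ne_zero_iff] at hq
    refine b.ext_elem fun j => ?_
    have h1 := mem_tangentSpaceAt.mp hδ _ (eval₂_mem_polyFun (fun i => (y i).2) (hb j) (P j))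
      fun w hw => by
        have := congrArg (fun g : coordinateRing Z => g.1 ⟨w, hw⟩) (hP0 j)
        simp only [coordinateRing_eval₂_apply] at this
        exact this
    rw [fderiv_eval₂_eq (fun i => (y i).2) (hb j) hyδ] at h1
    have h2 := (mul_eq_zero.mp h1).resolve_left (hq j (Finset.mem_univ j))
    have h3 : HasFDerivAt (fun w => b.coord j w) (b.coord j).toContinuousLinearMap z :=
      (b.coord j).toContinuousLinearMap.hasFDerivAt
    rw [h3.fderiv] at h2
    simpa using h2

end Jacobian

/-! ### Analytic charts at general points of an irreducible algebraic set. -/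

section Chart

open Polynomial

theorem dense_eval_ne_zero {σ : Type*} [Fintype σ] {p : MvPolynomial σ ℂ} (hp : p ≠ 0) :
    Dense {t : σ → ℂ | MvPolynomial.eval t p ≠ 0} := by
  rw [dense_iff_inter_open]
  intro U hU ⟨t, ht⟩
  by_contra hne
  obtain ⟨ε, hε, hball⟩ := Metric.isOpen_iff.mp hU t ht
  apply hp
  refine MvPolynomial.funext_set (fun i => Metric.ball (t i) ε) (fun i => ?_) fun x hx => ?_
  · exact infinite_of_mem_nhds (t i) (Metric.ball_mem_nhds _ hε)
  · by_contra h
    rw [map_zero] at h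
    exact hne ⟨x, hball (by rw [ball_pi _ hε]; exact hx), h⟩

theorem coord_mem_polyFun {σ : Type*} (i : σ) : (fun t : σ → ℂ => t i) ∈ polyFun (σ → ℂ) :=
  linear_mem_polyFun (LinearMap.proj i : (σ → ℂ) →ₗ[ℂ] ℂ)

theorem fst_coord_mem_polyFun {σ W : Type*} [AddCommGroup W] [Module ℂ W] (i : σ) :
    (fun u : (σ → ℂ) × W => u.1 i) ∈ polyFun ((σ → ℂ) × W) :=
  polyFun_comp_linear (coord_mem_polyFun i) (LinearMap.fst ℂ (σ → ℂ) W)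

theorem snd_mem_polyFun {W : Type*} [AddCommGroup W] [Module ℂ W] :
    (fun u : W × ℂ => u.2) ∈ polyFun (W × ℂ) :=
  linear_mem_polyFun (LinearMap.snd ℂ W ℂ)

theorem eval₂_prod_mem_polyFun {σ : Type*} (P : (MvPolynomial σ ℂ)[X]) :
    (fun u : (σ → ℂ) × ℂ => P.eval₂ (MvPolynomial.eval u.1) u.2) ∈ polyFun ((σ → ℂ) × ℂ) :=
  eval₂_mem_polyFun fst_coord_mem_polyFun snd_mem_polyFun P

/-- The analytic implicit function theorem for a simple root of a polynomial depending
polynomially on parameters. -/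
theorem exists_analytic_root {σ : Type*} [Fintype σ] (P : (MvPolynomial σ ℂ)[X]) {t₀ : σ → ℂ}
    {x₀ : ℂ} (h0 : P.eval₂ (MvPolynomial.eval t₀) x₀ = 0)
    (h1 : (derivative P).eval₂ (MvPolynomial.eval t₀) x₀ ≠ 0) :
    ∃ φ : (σ → ℂ) → ℂ, AnalyticAt ℂ φ t₀ ∧ φ t₀ = x₀ ∧
      (∀ᶠ t in 𝓝 t₀, P.eval₂ (MvPolynomial.eval t) (φ t) = 0) ∧
      ∀ᶠ u in 𝓝 (t₀, x₀), P.eval₂ (MvPolynomial.eval u.1) u.2 = 0 → φ u.1 = u.2 := by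
  let f : (σ → ℂ) × ℂ → ℂ := fun u => P.eval₂ (MvPolynomial.eval u.1) u.2
  have hf : f ∈ polyFun ((σ → ℂ) × ℂ) := eval₂_prod_mem_polyFun P
  have hcd : ContDiffAt ℂ ⊤ f (t₀, x₀) := (analyticAt_of_mem_polyFun hf _).contDiffAt
  have hd : fderiv ℂ f (t₀, x₀) (0, 1) = (derivative P).eval₂ (MvPolynomial.eval t₀) x₀ := by
    have hS : HasFDerivAt (fun u : (σ → ℂ) × ℂ => u.2) (ContinuousLinearMap.snd ℂ (σ → ℂ) ℂ)
      (t₀, x₀) := hasFDerivAt_snd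
    have := fderiv_eval₂_eq (y := fun i (u : (σ → ℂ) × ℂ) => u.1 i) (x := fun u => u.2)
      fst_coord_mem_polyFun snd_mem_polyFun (w := (t₀, x₀)) (δ := (0, 1))
      (fun i => by
        have hp : HasFDerivAt (fun u : (σ → ℂ) × ℂ => u.1 i)
          ((ContinuousLinearMap.proj i).comp (ContinuousLinearMap.fst ℂ (σ → ℂ) ℂ)) (t₀, x₀) :=
          ((ContinuousLinearMap.proj i).comp (ContinuousLinearMap.fst ℂ (σ → ℂ) ℂ)).hasFDerivAt
        rw [hp.fderiv]; simp) P
    rw [hS.fderiv] at this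
    simpa using this
  have hinv : (fderiv ℂ f (t₀, x₀) ∘L .inr ℂ (σ → ℂ) ℂ).IsInvertible := by
    refine ⟨ContinuousLinearEquiv.unitsEquivAut ℂ (Units.mk0 _ h1), ?_⟩
    ext
    simp [hd]
  refine ⟨hcd.implicitFunction (by simp) hinv, ?_, ?_, ?_, ?_⟩
  · exact (hcd.contDiffAt_implicitFunction (by simp) hinv).analyticAt
  · exact hcd.implicitFunction_apply_self (by simp) hinv
  · filter_upwards [hcd.eventually_apply_implicitFunction (by simp) hinv] with t ht
    exact ht.trans h0
  · filter_upwards [hcd.eventually_apply_eq_iff_implicitFunction (by simp) hinv] with u hu hP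
    exact hu.mp (hP.trans h0.symm)

variable {W : Type*} [NormedAddCommGroup W] [NormedSpace ℂ W] [FiniteDimensional ℂ W]
  {σ : Type*}

theorem analyticAt_eval₂ [Fintype σ] (P : (MvPolynomial σ ℂ)[X]) {φ : (σ → ℂ) → ℂ} {t₀ : σ → ℂ}
    (hφ : AnalyticAt ℂ φ t₀) :
    AnalyticAt ℂ (fun t => P.eval₂ (MvPolynomial.eval t) (φ t)) t₀ := by
  have h := analyticAt_of_mem_polyFun (eval₂_prod_mem_polyFun P) (t₀, φ t₀)
  exact h.comp₂ (f := fun t => t) analyticAt_id hφ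

theorem analyticAt_mvEval [Fintype σ] (r : MvPolynomial σ ℂ) (t₀ : σ → ℂ) :
    AnalyticAt ℂ (fun t => MvPolynomial.eval t r) t₀ :=
  analyticAt_of_mem_polyFun (aeval_mem_polyFun coord_mem_polyFun r) t₀

/-- Relations that hold on `Z` propagate along a root of the defining equation of a primitive
element. -/
theorem eval₂_root_eq_zero [Fintype σ] {P F T : (MvPolynomial σ ℂ)[X]} {r : MvPolynomial σ ℂ}
    (hr : r ≠ 0) (hF : C r * F = P * T) {U : Set (σ → ℂ)} (hU : IsOpen U) {φ : (σ → ℂ) → ℂ}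
    (hφ : ∀ t ∈ U, AnalyticAt ℂ φ t)
    (hP : ∀ t ∈ U, P.eval₂ (MvPolynomial.eval t) (φ t) = 0) :
    ∀ t ∈ U, F.eval₂ (MvPolynomial.eval t) (φ t) = 0 := by
  intro t ht
  -- The relation `r F = P T` gives the vanishing where `r ≠ 0`; this locus is dense, so it meets
  -- the open set on which the value would stay nonzero.
  by_contra hne
  have hev := ((analyticAt_eval₂ F (hφ t ht)).continuousAt.eventually_ne hne).and
    (hU.eventually_mem ht)
  obtain ⟨V, hV, hVo, htV⟩ := eventually_nhds_iff.mp hev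
  obtain ⟨s, hsV, hs⟩ := (dense_eval_ne_zero hr).inter_open_nonempty V hVo ⟨t, htV⟩
  have := congrArg (fun F => F.eval₂ (MvPolynomial.eval s) (φ s)) hF
  simp only [eval₂_mul, eval₂_C, hP s (hV s hsV).2, zero_mul] at this
  exact mul_ne_zero hs (hV s hsV).1 this

omit [FiniteDimensional ℂ W] in
/-- Clearing denominators in a polynomial function evaluated at a rational point. -/
theorem exists_clear_denominators {ι : Type*} [Fintype ι] (b : Module.Basis ι ℂ W) {Z : Set W}
    {y : σ → W → ℂ} {Θ : W → ℂ} {r : ι → MvPolynomial σ ℂ} {Q : ι → (MvPolynomial σ ℂ)[X]}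
    (hQ : ∀ j, ∀ z ∈ Z, MvPolynomial.eval (y · z) (r j) * b.coord j z
      = (Q j).eval₂ (MvPolynomial.eval (y · z)) (Θ z)) {f : W → ℂ} (hf : f ∈ polyFun W) :
    ∃ (M : MvPolynomial σ ℂ) (F : (MvPolynomial σ ℂ)[X]),
      (∀ z ∈ Z, MvPolynomial.eval (y · z) M * f z
        = F.eval₂ (MvPolynomial.eval (y · z)) (Θ z)) ∧
      ∀ t x, (∀ j, MvPolynomial.eval t (r j) ≠ 0) → MvPolynomial.eval t M ≠ 0 ∧
        MvPolynomial.eval t M * f (∑ j, ((Q j).eval₂ (MvPolynomial.eval t) x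
          / MvPolynomial.eval t (r j)) • b j) = F.eval₂ (MvPolynomial.eval t) x := by
  classical
  induction hf using polyFun_induction with
  | linear φ =>
    -- The product of all `r j` is the common denominator of the coordinates. The same `M` and `F`
    -- serve on `Z` and at an arbitrary parameter pair `(t, x)`.
    refine ⟨∏ j, r j, ∑ j, C (MvPolynomial.C (φ (b j)) * ∏ i ∈ Finset.univ.erase j, r i) * Q j,
      fun z hz => ?_, fun t x hr => ⟨?_, ?_⟩⟩
    · have h1 : φ z = ∑ j, b.coord j z * φ (b j) := by
        conv_lhs => rw [← b.sum_repr z, map_sum]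
        simp
      simp only [h1]
      rw [eval₂_finsetSum, Finset.mul_sum]
      refine Finset.sum_congr rfl fun j _ => ?_
      rw [eval₂_mul, eval₂_C, ← hQ j z hz, ← Finset.mul_prod_erase _ _ (Finset.mem_univ j)]
      simp only [map_mul, MvPolynomial.eval_C]
      ring
    · rw [map_prod]
      exact Finset.prod_ne_zero_iff.mpr fun j _ => hr j
    · simp only [map_sum, map_smul, smul_eq_mul]
      rw [eval₂_finsetSum, Finset.mul_sum]
      refine Finset.sum_congr rfl fun j _ => ?_
      have := hr j
      rw [eval₂_mul, eval₂_C, ← Finset.mul_prod_erase _ _ (Finset.mem_univ j)]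
      simp only [map_mul, MvPolynomial.eval_C]
      field_simp
  | const c =>
    exact ⟨1, C (MvPolynomial.C c), by simp, by simp⟩
  | add f g _ _ h1 h2 =>
    obtain ⟨M, F, h1, h1'⟩ := h1
    obtain ⟨N, G, h2, h2'⟩ := h2
    refine ⟨M * N, C N * F + C M * G, fun z hz => ?_, fun t x hr => ⟨?_, ?_⟩⟩
    · simp only [map_mul, eval₂_add, eval₂_mul, eval₂_C, ← h1 z hz, ← h2 z hz]
      ring
    · rw [map_mul]
      exact mul_ne_zero (h1' t x hr).1 (h2' t x hr).1
    · simp only [map_mul, eval₂_add, eval₂_mul, eval₂_C, ← (h1' t x hr).2, ← (h2' t x hr).2]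
      ring
  | mul f g _ _ h1 h2 =>
    obtain ⟨M, F, h1, h1'⟩ := h1
    obtain ⟨N, G, h2, h2'⟩ := h2
    refine ⟨M * N, F * G, fun z hz => ?_, fun t x hr => ⟨?_, ?_⟩⟩
    · simp only [map_mul, eval₂_mul, ← h1 z hz, ← h2 z hz]
      ring
    · rw [map_mul]
      exact mul_ne_zero (h1' t x hr).1 (h2' t x hr).1
    · simp only [map_mul, eval₂_mul, ← (h1' t x hr).2, ← (h2' t x hr).2]
      ring

/-- At a general point of an irreducible algebraic set, a transcendence basis consisting of
polynomial functions is a system of local analytic coordinates. -/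
theorem exists_generic_chart [Fintype σ] {Z : Set W} (hZ : IsIrreducibleSet Z)
    (hcl : ∀ v ∉ Z, ∃ f ∈ polyFun W, (∀ w ∈ Z, f w = 0) ∧ f v ≠ 0) {y : σ → polyFun W}
    (hy : IsTranscendenceBasis ℂ fun i => restrictHom Z (y i)) :
    ∃ q ∈ polyFun W, (∃ z ∈ Z, q z ≠ 0) ∧ ∀ v ∈ Z, q v ≠ 0 →
      ∃ G : (σ → ℂ) → W, AnalyticAt ℂ G (fun i => (y i : W → ℂ) v) ∧
        G (fun i => (y i : W → ℂ) v) = v ∧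
        (∀ᶠ t in 𝓝 (fun i => (y i : W → ℂ) v), G t ∈ Z ∧ ∀ i, (y i : W → ℂ) (G t) = t i) ∧
        ∀ᶠ w in 𝓝 v, w ∈ Z → G (fun i => (y i : W → ℂ) w) = w := by
  have := hZ.isDomain
  have := coordinateRing_finiteType Z
  let b := Module.finBasis ℂ W
  have hb : ∀ j, (fun w => b.coord j w) ∈ polyFun W := fun j => linear_mem_polyFun _
  -- Wherever the `r j` below are nonzero, a point of `Z` is determined by its `y`-values and the
  -- value of `θ`, a simple root of `P` where `P' ≠ 0`.
  obtain ⟨θ, P, hP0, hP1, hrat, hdiv⟩ := exists_primitive_relation hy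
  obtain ⟨⟨Θ, hΘ⟩, rfl⟩ := restrictHom_surjective Z θ
  choose r hr0 Q hrQ using fun j => hrat (restrictHom Z ⟨_, hb j⟩)
  -- the relations on points of `Z`
  have hPz : ∀ z ∈ Z, P.eval₂ (MvPolynomial.eval fun i => (y i : W → ℂ) z) (Θ z) = 0 := by
    intro z hz
    have := congrArg (fun g : coordinateRing Z => g.1 ⟨z, hz⟩) hP0
    simp only [coordinateRing_eval₂_apply] at this
    exact this
  have hQz : ∀ j, ∀ z ∈ Z, MvPolynomial.eval (fun i => (y i : W → ℂ) z) (r j) * b.coord j z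
      = (Q j).eval₂ (MvPolynomial.eval fun i => (y i : W → ℂ) z) (Θ z) := by
    intro j z hz
    have := congrArg (fun g : coordinateRing Z => g.1 ⟨z, hz⟩) (hrQ j)
    simp only [coordinateRing_eval₂_apply, MulMemClass.coe_mul, Pi.mul_apply,
      coordinateRing_aeval_apply] at this
    exact this
  have hdivz : ∀ F : (MvPolynomial σ ℂ)[X],
      (∀ z ∈ Z, F.eval₂ (MvPolynomial.eval fun i => (y i : W → ℂ) z) (Θ z) = 0) →
      ∃ r : MvPolynomial σ ℂ, r ≠ 0 ∧ ∃ T : (MvPolynomial σ ℂ)[X], C r * F = P * T := by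
    intro F hF
    refine hdiv F (Subtype.ext (funext fun z => ?_))
    rw [coordinateRing_eval₂_apply]
    exact hF z z.2
  have hrmem : ∀ j, (fun w => MvPolynomial.eval (fun i => (y i : W → ℂ) w) (r j)) ∈ polyFun W :=
    fun j => aeval_mem_polyFun (fun i => (y i).2) (r j)
  have hP'mem := eval₂_mem_polyFun (fun i => (y i).2) hΘ (derivative P)
  have hprod := prod_mem fun j (_ : j ∈ Finset.univ) => hrmem j
  refine ⟨_, mul_mem hP'mem hprod, ?_, fun v hv hq => ?_⟩
  · refine hZ.exists_mul_ne_zero hP'mem hprod ?_ ?_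
    · by_contra! h
      refine hP1 (Subtype.ext (funext fun z => ?_))
      rw [coordinateRing_eval₂_apply]
      exact h z z.2
    · have := hZ.exists_prod_ne_zero Finset.univ (fun j _ => hrmem j) fun j _ => by
        by_contra! h
        refine hr0 j (hy.1 ?_)
        rw [map_zero]
        refine Subtype.ext (funext fun z => ?_)
        rw [coordinateRing_aeval_apply]
        exact h z z.2
      simpa using this
  · simp only [Pi.mul_apply, Finset.prod_apply] at hq
    have hP'v := left_ne_zero_of_mul hq
    have hrv : ∀ j, MvPolynomial.eval (fun i => (y i : W → ℂ) v) (r j) ≠ 0 := fun j =>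
      Finset.prod_ne_zero_iff.mp (right_ne_zero_of_mul hq) j (Finset.mem_univ j)
    obtain ⟨φ, hφa, hφv, hφP, hφu⟩ := exists_analytic_root P (hPz v hv) hP'v
    set Y : W → σ → ℂ := fun w i => (y i : W → ℂ) w with hY
    -- The rational inverse of `w ↦ (y w, Θ w)`; composing it with the analytic root `φ` gives the
    -- chart.
    let G₀ : (σ → ℂ) → ℂ → W := fun t x => ∑ j, ((Q j).eval₂ (MvPolynomial.eval t) x
          / MvPolynomial.eval t (r j)) • b j
    have hG₀ : ∀ w ∈ Z, (∀ j, MvPolynomial.eval (Y w) (r j) ≠ 0) → G₀ (Y w) (Θ w) = w := by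
      intro w hw hrw
      refine b.ext_elem fun j => ?_
      simp only [G₀, map_sum, map_smul, Finsupp.coe_finsetSum, Finset.sum_apply, Finsupp.smul_apply,
        Module.Basis.repr_self, smul_eq_mul, Finsupp.single_apply, mul_ite, mul_one, mul_zero,
        Finset.sum_ite_eq', Finset.mem_univ, if_true]
      rw [div_eq_iff (hrw j), ← hQz j w hw, b.coord_apply, mul_comm]
    have hrne : ∀ᶠ t in 𝓝 (Y v), ∀ j, MvPolynomial.eval t (r j) ≠ 0 :=
      Filter.eventually_all.mpr fun j =>
        (analyticAt_mvEval (r j) (Y v)).continuousAt.eventually_ne (hrv j)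
    obtain ⟨U, hU, hUo, hvU⟩ := eventually_nhds_iff.mp
      (hφP.and (hφa.eventually_analyticAt.and hrne))
    -- Relations valid on `Z` persist at `(t, φ t)`, although it is not yet known that these
    -- parameters come from points of `Z`.
    have hroot : ∀ F : (MvPolynomial σ ℂ)[X],
        (∀ z ∈ Z, F.eval₂ (MvPolynomial.eval (Y z)) (Θ z) = 0) →
        ∀ t ∈ U, F.eval₂ (MvPolynomial.eval t) (φ t) = 0 := by
      intro F hF
      obtain ⟨r', hr', T, hT⟩ := hdivz F hF
      exact eval₂_root_eq_zero hr' hT hUo (fun t ht => (hU t ht).2.1) fun t ht => (hU t ht).1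
    have hYc : ContinuousAt Y v :=
      continuousAt_pi.mpr fun i => (analyticAt_of_mem_polyFun (y i).2 v).continuousAt
    have hΘc : ContinuousAt Θ v := (analyticAt_of_mem_polyFun hΘ v).continuousAt
    refine ⟨fun t => G₀ t (φ t), ?_, ?_, ?_, ?_⟩
    · refine Finset.analyticAt_fun_sum _ fun j _ => ?_
      exact ((analyticAt_eval₂ (Q j) hφa).div (analyticAt_mvEval (r j) _) (hrv j)).smul
        analyticAt_const
    · change G₀ (Y v) (φ (Y v)) = v
      rw [hφv]
      exact hG₀ v hv hrv
    · filter_upwards [hUo.mem_nhds hvU] with t ht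
      constructor
      -- A function vanishing on `Z` but not at `G t` would, after clearing denominators, be a
      -- relation on `Z` failing at `(t, φ t)`.
      · by_contra hG
        obtain ⟨f, hf, hfZ, hfG⟩ := hcl _ hG
        obtain ⟨M, F, hF, hF'⟩ := exists_clear_denominators b hQz hf
        obtain ⟨hM, hF'⟩ := hF' t (φ t) (hU t ht).2.2
        rw [hroot F (fun z hz => by rw [← hF z hz, hfZ z hz, mul_zero]) t ht] at hF'
        exact mul_ne_zero hM hfG hF'
      · intro i
        obtain ⟨M, F, hF, hF'⟩ := exists_clear_denominators b hQz (y i).2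
        obtain ⟨hM, hF'⟩ := hF' t (φ t) (hU t ht).2.2
        have := hroot (F - C (M * MvPolynomial.X i)) (fun z hz => by
          rw [eval₂_sub, eval₂_C, ← hF z hz, map_mul, MvPolynomial.eval_X, sub_self]) t ht
        rw [eval₂_sub, eval₂_C, ← hF', map_mul, MvPolynomial.eval_X, ← mul_sub] at this
        exact sub_eq_zero.mp ((mul_eq_zero.mp this).resolve_left hM)
    -- Near `v` the local uniqueness of the root forces `Θ w = φ (Y w)` for `w` in `Z`.
    · have h1 : Filter.Tendsto (fun w => (Y w, Θ w)) (𝓝 v) (𝓝 (Y v, Θ v)) :=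
        hYc.prodMk_nhds hΘc
      filter_upwards [h1.eventually hφu, hYc.eventually hrne] with w hw hrw hwZ
      change G₀ (Y w) (φ (Y w)) = w
      rw [hw (hPz w hwZ)]
      exact hG₀ w hwZ hrw

end Chart

/-! ### Dimension of affine algebraic sets. -/

section AffineDim

variable {W : Type*} [AddCommGroup W] [Module ℂ W]

/-- The dimension of an affine algebraic set. -/
noncomputable def affineDim (Z : Set W) : ℕ :=
  ((ringKrullDim (coordinateRing Z)).unbotD 0).toNat

theorem dim_eq_affineDim (Y : Set (ℙ ℂ W)) : dim Y = (affineDim (cone Y) : ℤ) - 1 := rfl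

/-- Sets that are the common zero locus of the polynomial functions vanishing on them. -/
def IsAlgebraicSet (Z : Set W) : Prop :=
  ∀ v ∉ Z, ∃ f ∈ polyFun W, (∀ w ∈ Z, f w = 0) ∧ f v ≠ 0

theorem IsAlgebraicSet.prod_univ {W' : Type*} [AddCommGroup W'] [Module ℂ W'] {Z : Set W}
    (hZ : IsAlgebraicSet Z) : IsAlgebraicSet (Z ×ˢ (Set.univ : Set W')) := by
  intro v hv
  obtain ⟨f, hf, hfZ, hfv⟩ := hZ v.1 fun h => hv ⟨h, trivial⟩
  exact ⟨_, polyFun_comp_linear hf (LinearMap.fst ℂ W W'), fun w hw => hfZ w.1 hw.1, hfv⟩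

variable [FiniteDimensional ℂ W]

theorem IsIrreducibleSet.ringKrullDim_eq {Z : Set W} (hZ : IsIrreducibleSet Z) :
    ringKrullDim (coordinateRing Z) = affineDim Z ∧
      Algebra.trdeg ℂ (coordinateRing Z) = affineDim Z := by
  have := hZ.isDomain
  have := coordinateRing_finiteType Z
  obtain ⟨n, hn, htr⟩ := ringKrullDim_eq_trdeg ℂ (coordinateRing Z)
  have : affineDim Z = n := by
    rw [affineDim, hn]; rfl
  rw [this]
  exact ⟨hn, htr⟩

theorem IsIrreducibleSet.card_le_affineDim {Z : Set W} (hZ : IsIrreducibleSet Z) {m : ℕ}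
    {y : Fin m → coordinateRing Z} (hy : AlgebraicIndependent ℂ y) : m ≤ affineDim Z := by
  have := hy.lift_cardinalMk_le_trdeg
  rw [hZ.ringKrullDim_eq.2] at this
  simpa using this

/-- A transcendence basis of the coordinate ring can be chosen among the linear forms. -/
theorem IsIrreducibleSet.exists_linear_basis {Z : Set W} (hZ : IsIrreducibleSet Z) :
    ∃ S : Fin (affineDim Z) → Module.Dual ℂ W, IsTranscendenceBasis ℂ fun i =>
      restrictHom Z ⟨fun w => S i w, linear_mem_polyFun (S i)⟩ := by
  have := hZ.isDomain
  set s : Set (coordinateRing Z) := Set.range fun φ : Module.Dual ℂ W =>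
      restrictHom Z ⟨fun w => φ w, linear_mem_polyFun φ⟩ with hs
  have hs' : Algebra.adjoin ℂ s = ⊤ := coordinateRing_adjoin_linear Z
  have : Algebra.IsAlgebraic (Algebra.adjoin ℂ s) (coordinateRing Z) := by
    rw [hs']
    exact ⟨fun a => isAlgebraic_algebraMap (⟨a, trivial⟩ : (⊤ : Subalgebra ℂ (coordinateRing Z)))⟩
  have : FaithfulSMul ℂ (coordinateRing Z) :=
    (faithfulSMul_iff_algebraMap_injective _ _).mpr (algebraMap ℂ (coordinateRing Z)).injective
  obtain ⟨t, hts, ht⟩ := exists_isTranscendenceBasis_subset (R := ℂ) s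
  have hcard := ht.cardinalMk_eq_trdeg
  rw [hZ.ringKrullDim_eq.2] at hcard
  have hfin : Finite t := Cardinal.mk_lt_aleph0_iff.mp (hcard ▸ Cardinal.natCast_lt_aleph0)
  have hcard' : Nat.card t = affineDim Z := by rw [Nat.card, hcard, Cardinal.toNat_natCast]
  let e : Fin (affineDim Z) ≃ t := (Finite.equivFinOfCardEq hcard').symm
  choose S hS using fun i => hts (e i).2
  refine ⟨S, ?_⟩
  have : (fun i => restrictHom Z ⟨fun w => S i w, linear_mem_polyFun (S i)⟩)
      = (Subtype.val : t → coordinateRing Z) ∘ e := funext hS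
  rw [this]
  exact ht.comp_equiv e

end AffineDim

/-! ### Coordinates on the tangent space at general points. -/

section Tangent

variable {W : Type*} [NormedAddCommGroup W] [NormedSpace ℂ W] [FiniteDimensional ℂ W]

theorem fderiv_linear_apply (φ : Module.Dual ℂ W) (w δ : W) :
    fderiv ℂ (fun w => φ w) w δ = φ δ := by
  have : HasFDerivAt (fun w => φ w) φ.toContinuousLinearMap w :=
    φ.toContinuousLinearMap.hasFDerivAt
  rw [this.fderiv]
  rfl

theorem fderiv_mem_tangentSpaceAt {E : Type*} [NormedAddCommGroup E] [NormedSpace ℂ E] {Z : Set W}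
    {G : E → W} {t₀ : E} (hG : DifferentiableAt ℂ G t₀) (hZ : ∀ᶠ t in 𝓝 t₀, G t ∈ Z) (τ : E) :
    fderiv ℂ G t₀ τ ∈ tangentSpaceAt Z (G t₀) := by
  rw [mem_tangentSpaceAt]
  intro f hf hfZ
  have h1 : (fun t => f (G t)) =ᶠ[𝓝 t₀] fun _ => 0 := hZ.mono fun t ht => hfZ _ ht
  have h2 := fderiv_comp t₀ (differentiableAt_of_mem_polyFun hf (G t₀)) hG
  have h3 : fderiv ℂ (f ∘ G) t₀ = 0 := by
    have := h1.fderiv_eq (𝕜 := ℂ)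
    rw [fderiv_fun_const] at this
    exact this
  rw [h3] at h2
  exact (congrArg (fun L => L τ) h2).symm

/-- Differentials of a transcendence basis are coordinates on the tangent space at a general
point. -/
theorem exists_generic_tangent_bijective {σ : Type*} [Finite σ] {Z : Set W}
    (hZ : IsIrreducibleSet Z) (hcl : IsAlgebraicSet Z) {y : σ → polyFun W}
    (hy : IsTranscendenceBasis ℂ fun i => restrictHom Z (y i)) :
    ∃ q ∈ polyFun W, (∃ z ∈ Z, q z ≠ 0) ∧ ∀ z ∈ Z, q z ≠ 0 →
      Function.Bijective fun (δ : tangentSpaceAt Z z) (i : σ) => fderiv ℂ (y i : W → ℂ) z δ := by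
  have := Fintype.ofFinite σ
  obtain ⟨q, hq, hq0, hqc⟩ := exists_generic_chart hZ hcl hy
  obtain ⟨q', hq', hq'0, hqs⟩ := exists_generic_separating hZ hy
  refine ⟨_, mul_mem hq hq', hZ.exists_mul_ne_zero hq hq' hq0 hq'0, fun z hz hqz => ⟨?_, ?_⟩⟩
  · intro δ δ' h
    have := hqs z hz (right_ne_zero_of_mul hqz) _ (δ - δ').2 fun i => by
      have := congrFun h i
      simp only at this
      simp [this]
    exact sub_eq_zero.mp (Subtype.ext this)
  -- The derivative of the chart in the direction `τ` is a tangent vector with coordinates `τ`,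
  -- because `y ∘ G` is the identity near the centre.
  · obtain ⟨G, hGa, hGz, hGZ, -⟩ := hqc z hz (left_ne_zero_of_mul hqz)
    intro τ
    have hmem := fderiv_mem_tangentSpaceAt hGa.differentiableAt (hGZ.mono fun t ht => ht.1) τ
    rw [hGz] at hmem
    refine ⟨⟨_, hmem⟩, funext fun i => ?_⟩
    have h1 : (fun t => (y i : W → ℂ) (G t)) =ᶠ[𝓝 _] fun t => t i := hGZ.mono fun t ht => ht.2 i
    have h2 := fderiv_comp _ (differentiableAt_of_mem_polyFun (y i).2 (G _)) hGa.differentiableAt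
    have h3 := h1.fderiv_eq (𝕜 := ℂ)
    have h4 := fderiv_linear_apply (LinearMap.proj i : (σ → ℂ) →ₗ[ℂ] ℂ)
      (fun i => (y i : W → ℂ) z) τ
    rw [hGz] at h2
    exact (congrArg (fun L => L τ) (h2.symm.trans h3)).trans h4

/-- The tangent space at a general point has the dimension of the set. -/
theorem exists_generic_finrank_tangent {Z : Set W}
    (hZ : IsIrreducibleSet Z) (hcl : IsAlgebraicSet Z) :
    ∃ q ∈ polyFun W, (∃ z ∈ Z, q z ≠ 0) ∧ ∀ z ∈ Z, q z ≠ 0 →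
      Module.finrank ℂ (tangentSpaceAt Z z) = affineDim Z := by
  obtain ⟨S, hS⟩ := hZ.exists_linear_basis
  obtain ⟨q, hq, hq0, h⟩ := exists_generic_tangent_bijective hZ hcl
    (y := fun i => ⟨fun w => S i w, linear_mem_polyFun (S i)⟩) hS
  refine ⟨q, hq, hq0, fun z hz hqz => ?_⟩
  have h1 := h z hz hqz
  simp only [fderiv_linear_apply] at h1
  let L : tangentSpaceAt Z z →ₗ[ℂ] (Fin (affineDim Z) → ℂ) :=
    LinearMap.pi fun i => (S i) ∘ₗ (tangentSpaceAt Z z).subtype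
  rw [(LinearEquiv.ofBijective L h1).finrank_eq]
  simp

/-- Algebraically independent polynomial functions have independent differentials at a general
point. -/
theorem exists_generic_surjective {Z : Set W} (hZ : IsIrreducibleSet Z) (hcl : IsAlgebraicSet Z)
    {m : ℕ} {y : Fin m → polyFun W}
    (hy : AlgebraicIndependent ℂ fun i => restrictHom Z (y i)) :
    ∃ q ∈ polyFun W, (∃ z ∈ Z, q z ≠ 0) ∧ ∀ z ∈ Z, q z ≠ 0 →
      Function.Surjective fun (δ : tangentSpaceAt Z z) (i : Fin m) =>
        fderiv ℂ (y i : W → ℂ) z δ := by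
  have := hZ.isDomain
  -- Extend the family to a transcendence basis, whose differentials are coordinates on the tangent
  -- space; a subfamily of coordinates is surjective.
  obtain ⟨u, hu, hub⟩ := exists_isTranscendenceBasis_superset hy.to_subtype_range
  have hcard := hub.cardinalMk_eq_trdeg
  rw [hZ.ringKrullDim_eq.2] at hcard
  have hfin : Finite u := Cardinal.mk_lt_aleph0_iff.mp (hcard ▸ Cardinal.natCast_lt_aleph0)
  let e : Fin m → u := fun i => ⟨_, hu ⟨i, rfl⟩⟩
  have he : Function.Injective e := fun i j hij => hy.injective (congrArg Subtype.val hij)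
  -- The lifts are chosen to be the given `y i` on the original members, so that no comparison of
  -- differentials of different lifts is needed.
  have hlift : ∀ a : u, ∃ f : polyFun W, restrictHom Z f = a ∧ ∀ i, a = e i → f = y i := by
    intro a
    by_cases ha : ∃ i, a = e i
    · obtain ⟨i, rfl⟩ := ha
      exact ⟨y i, rfl, fun j hj => by rw [he hj]⟩
    · obtain ⟨f, hf⟩ := restrictHom_surjective Z a.1
      exact ⟨f, hf, fun i hi => (ha ⟨i, hi⟩).elim⟩
  choose Y hY hYy using hlift
  have hYb : IsTranscendenceBasis ℂ fun a => restrictHom Z (Y a) := by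
    have : (fun a => restrictHom Z (Y a)) = Subtype.val := funext hY
    rwa [this]
  obtain ⟨q, hq, hq0, h⟩ := exists_generic_tangent_bijective hZ hcl hYb
  refine ⟨q, hq, hq0, fun z hz hqz τ => ?_⟩
  obtain ⟨δ, hδ⟩ := (h z hz hqz).2 (Function.extend e τ 0)
  refine ⟨δ, funext fun i => ?_⟩
  have := congrFun hδ (e i)
  rw [he.extend_apply] at this
  rw [← this]
  simp only [hYy (e i) i rfl]

end Tangent

/-! ### Tangent and conormal spaces of cones. -/

section ConeTangent

variable {V : Type*} [NormedAddCommGroup V] [NormedSpace ℂ V]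

theorem coneTangentSpace_eq (X : Set (ℙ ℂ V)) (v : V) :
    coneTangentSpace X v = tangentSpaceAt (cone X) v := rfl

variable [FiniteDimensional ℂ V]

theorem fderiv_comp_smul {f : V → ℂ} (hf : f ∈ polyFun V) (a : ℂ) (v δ : V) :
    fderiv ℂ (fun w => f (a • w)) v δ = a * fderiv ℂ f (a • v) δ := by
  have h1 : HasFDerivAt (fun w : V => a • w) (a • ContinuousLinearMap.id ℂ V) v :=
    (hasFDerivAt_id v).const_smul a
  have h2 := (differentiableAt_of_mem_polyFun hf (a • v)).hasFDerivAt.comp v h1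
  have h3 : fderiv ℂ (fun w => f (a • w)) v = _ := h2.fderiv
  rw [h3]
  simp

theorem coneTangentSpace_le_smul (X : Set (ℙ ℂ V)) {a : ℂ} (ha : a ≠ 0) (v : V) :
    coneTangentSpace X v ≤ coneTangentSpace X (a • v) := by
  intro δ hδ
  rw [coneTangentSpace_eq, mem_tangentSpaceAt] at hδ ⊢
  intro f hf hfX
  have := hδ _ (polyFun_comp_linear hf (a • LinearMap.id)) fun w hw => by
    simpa using hfX _ (smul_mem_cone hw a)
  simp only [LinearMap.smul_apply, LinearMap.id_apply] at this
  rw [fderiv_comp_smul hf] at this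
  exact (mul_eq_zero.mp this).resolve_left ha

theorem coneTangentSpace_smul (X : Set (ℙ ℂ V)) {a : ℂ} (ha : a ≠ 0) (v : V) :
    coneTangentSpace X (a • v) = coneTangentSpace X v := by
  refine le_antisymm ?_ (coneTangentSpace_le_smul X ha v)
  have := coneTangentSpace_le_smul X (inv_ne_zero ha) (a • v)
  rwa [smul_smul, inv_mul_cancel₀ ha, one_smul] at this

theorem embeddedTangentSpace_eq (X : Set (ℙ ℂ V)) {x : ℙ ℂ V} {v : V} (hv : v ≠ 0)
    (hvx : v ∈ x.submodule) : embeddedTangentSpace X x = coneTangentSpace X v := by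
  rw [Projectivization.submodule_eq, Submodule.mem_span_singleton] at hvx
  obtain ⟨a, rfl⟩ := hvx
  have ha : a ≠ 0 := fun h => hv (by rw [h, zero_smul])
  exact (coneTangentSpace_smul X ha _).symm

/-- The line `s ↦ s • v` stays in the cone and has velocity `v`. -/
theorem self_mem_coneTangentSpace {X : Set (ℙ ℂ V)} {v : V} (hv : v ∈ cone X) :
    v ∈ coneTangentSpace X v := by
  have hG : HasFDerivAt (fun s : ℂ => s • v)
      ((ContinuousLinearMap.id ℂ ℂ).smulRight v) (1 : ℂ) :=
    (hasFDerivAt_id (1 : ℂ)).smul_const v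
  have := fderiv_mem_tangentSpaceAt (Z := cone X) hG.differentiableAt
    (Filter.Eventually.of_forall fun s => smul_mem_cone hv s) 1
  rw [hG.fderiv] at this
  rw [coneTangentSpace_eq]
  simpa using this

/-- The differential of `f` at `v` as a linear form. -/
noncomputable def differential (f : V → ℂ) (v : V) : Module.Dual ℂ V :=
  (fderiv ℂ f v).toLinearMap

omit [FiniteDimensional ℂ V] in
@[simp]
theorem differential_apply (f : V → ℂ) (v δ : V) : differential f v δ = fderiv ℂ f v δ := rfl

/-- The conormal space is the space of differentials of functions vanishing on the set. -/
theorem mem_dualAnnihilator_tangentSpaceAt {Z : Set V} {v : V} {ξ : Module.Dual ℂ V} :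
    ξ ∈ (tangentSpaceAt Z v).dualAnnihilator ↔
      ∃ f ∈ polyFun V, (∀ w ∈ Z, f w = 0) ∧ differential f v = ξ := by
  -- The differentials already form a subspace, with coannihilator the tangent space; in finite
  -- dimension it is therefore the whole annihilator.
  let D : Submodule ℂ (Module.Dual ℂ V) :=
    { carrier := {ξ | ∃ f ∈ polyFun V, (∀ w ∈ Z, f w = 0) ∧ differential f v = ξ}
      zero_mem' := ⟨0, zero_mem _, fun _ _ => rfl, by ext; simp [differential]⟩
      add_mem' := by
        rintro _ _ ⟨f, hf, hfZ, rfl⟩ ⟨g, hg, hgZ, rfl⟩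
        refine ⟨f + g, add_mem hf hg, fun w hw => by simp [hfZ w hw, hgZ w hw], ?_⟩
        ext δ
        simp [fderiv_add (differentiableAt_of_mem_polyFun hf v)
          (differentiableAt_of_mem_polyFun hg v)]
      smul_mem' := by
        rintro c _ ⟨f, hf, hfZ, rfl⟩
        refine ⟨c • f, Subalgebra.smul_mem _ hf c, fun w hw => by simp [hfZ w hw], ?_⟩
        ext δ
        simp [fderiv_const_smul (differentiableAt_of_mem_polyFun hf v)] }
  have hD : tangentSpaceAt Z v = D.dualCoannihilator := by
    ext δ
    rw [mem_tangentSpaceAt, Submodule.mem_dualCoannihilator]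
    constructor
    · rintro h _ ⟨f, hf, hfZ, rfl⟩
      exact h f hf hfZ
    · intro h f hf hfZ
      exact h _ ⟨f, hf, hfZ, rfl⟩
  rw [hD, Subspace.dualCoannihilator_dualAnnihilator_eq]
  exact Iff.rfl

theorem comp_differential_mem_polyFun {g : Module.Dual ℂ V → ℂ}
    (hg : g ∈ polyFun (Module.Dual ℂ V)) {f : V → ℂ} (hf : f ∈ polyFun V) :
    (fun v => g (differential f v)) ∈ polyFun V := by
  induction hg using polyFun_induction with
  | linear φ =>
    obtain ⟨u, rfl⟩ := (Module.evalEquiv ℂ V).surjective φ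
    exact fderiv_mem_polyFun hf u
  | const c => exact const_mem_polyFun c
  | add f g _ _ h1 h2 => exact add_mem h1 h2
  | mul f g _ _ h1 h2 => exact mul_mem h1 h2

end ConeTangent

/-! ### The ideal of the dual cone. -/

section DualCone

variable {V : Type*} [NormedAddCommGroup V] [NormedSpace ℂ V] [FiniteDimensional ℂ V]

omit [FiniteDimensional ℂ V] in
theorem mk_eq_of_mem_submodule {x : ℙ ℂ V} {v : V} (hv : v ≠ 0) (hvx : v ∈ x.submodule) :
    Projectivization.mk ℂ v hv = x := by
  rw [Projectivization.submodule_eq, Submodule.mem_span_singleton] at hvx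
  obtain ⟨a, ha⟩ := hvx
  conv_rhs => rw [← x.mk_rep]
  exact (Projectivization.mk_eq_mk_iff' ℂ _ _ _ _).mpr ⟨a, ha⟩

omit [FiniteDimensional ℂ V] in
theorem IsProjectiveVariety.isAlgebraicSet_cone {X : Set (ℙ ℂ V)} (hX : IsProjectiveVariety X) :
    IsAlgebraicSet (cone X) := fun _ hv => exists_ne_zero_of_notMem_cone hX.1 hv

theorem isSmoothPoint_iff {X : Set (ℙ ℂ V)} {x : ℙ ℂ V} {v : V} (hv : v ≠ 0)
    (hvx : v ∈ x.submodule) (hvX : v ∈ cone X) :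
    IsSmoothPoint X x ↔ Module.finrank ℂ (tangentSpaceAt (cone X) v) = affineDim (cone X) := by
  have hx : x ∈ X := mk_eq_of_mem_submodule hv hvx ▸ hvX hv
  rw [IsSmoothPoint, embeddedTangentSpace_eq X hv hvx, coneTangentSpace_eq, dim_eq_affineDim]
  constructor
  · rintro ⟨-, h⟩; omega
  · intro h; exact ⟨hx, by omega⟩

theorem mem_cone_tangentHyperplanes {X : Set (ℙ ℂ V)} {v : V} (hv : v ≠ 0) (hvX : v ∈ cone X)
    (hsm : Module.finrank ℂ (tangentSpaceAt (cone X) v) = affineDim (cone X))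
    {ξ : Module.Dual ℂ V} (hξ : ξ ∈ (tangentSpaceAt (cone X) v).dualAnnihilator) :
    ξ ∈ cone {H | IsTangentHyperplane X H} := by
  intro hξ0
  have hmem : v ∈ (Projectivization.mk ℂ v hv).submodule := by
    rw [Projectivization.submodule_mk]; exact Submodule.mem_span_singleton_self v
  refine ⟨Projectivization.mk ℂ v hv, (isSmoothPoint_iff hv hmem hvX).mpr hsm, fun w hw => ?_⟩
  rw [embeddedTangentSpace_eq X hv hmem, coneTangentSpace_eq] at hw
  obtain ⟨a, ha⟩ := Projectivization.exists_smul_eq_mk_rep ℂ ξ hξ0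
  rw [← ha]
  have := (Submodule.mem_dualAnnihilator ξ).mp hξ w hw
  rw [Units.smul_def, LinearMap.smul_apply, this, smul_zero]

/-- The polynomial functions vanishing on the cone over the dual variety. -/
theorem vanishes_on_dual_cone_iff {X : Set (ℙ ℂ V)} (hX : IsProjectiveVariety X)
    (hdim : 0 < affineDim (cone X)) {g : Module.Dual ℂ V → ℂ}
    (hg : g ∈ polyFun (Module.Dual ℂ V)) :
    (∀ ξ ∈ cone (dualVariety X), g ξ = 0) ↔
      ∀ f ∈ polyFun V, (∀ w ∈ cone X, f w = 0) → ∀ v ∈ cone X, g (differential f v) = 0 := by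
  have hZ := hX.isIrreducibleSet_cone
  constructor
  · intro h f hf hfX
    obtain ⟨S, hS⟩ := hZ.exists_linear_basis
    obtain ⟨q, hq, hq0, hqs⟩ := exists_generic_finrank_tangent hZ hX.isAlgebraicSet_cone
    -- A linear form not vanishing on the cone excludes the vertex, so a general `v` represents a
    -- smooth point of `X` and `df(v)` is zero or a tangent hyperplane.
    have hS0 : ∃ z ∈ cone X, S ⟨0, hdim⟩ z ≠ 0 := by
      by_contra! h0
      refine hS.1.ne_zero ⟨0, hdim⟩ (Subtype.ext (funext fun z => ?_))
      exact h0 z z.2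
    refine hZ.eq_zero_of_generic (mul_mem hq (linear_mem_polyFun (S ⟨0, hdim⟩)))
      (comp_differential_mem_polyFun hg hf)
      (hZ.exists_mul_ne_zero hq (linear_mem_polyFun _) hq0 hS0) fun v hv hqv => ?_
    have hv0 : v ≠ 0 := by
      rintro rfl
      exact right_ne_zero_of_mul hqv (map_zero _)
    refine h _ (subset_cone_closure _ (mem_cone_tangentHyperplanes hv0 hv
      (hqs v hv (left_ne_zero_of_mul hqv)) ?_))
    exact mem_dualAnnihilator_tangentSpaceAt.mpr ⟨f, hf, hfX, rfl⟩
  · intro h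
    refine eq_zero_on_cone_closure hg fun ξ hξ => ?_
    by_cases hξ0 : ξ = 0
    -- The zero covector belongs to every cone; it is the differential of `f = 0`.
    · have := h 0 (zero_mem _) (fun _ _ => rfl) 0 (zero_mem_cone X)
      convert this
      rw [hξ0]
      ext δ
      simp
    · obtain ⟨x, hx, hxt⟩ := hξ hξ0
      obtain ⟨a, ha⟩ := Projectivization.exists_smul_eq_mk_rep ℂ ξ hξ0
      have hmem : ξ ∈ (tangentSpaceAt (cone X) x.rep).dualAnnihilator := by
        rw [Submodule.mem_dualAnnihilator]
        intro w hw
        have := hxt w hw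
        rw [← ha, Units.smul_def, LinearMap.smul_apply, smul_eq_mul] at this
        exact (mul_eq_zero.mp this).resolve_left a.ne_zero
      obtain ⟨f, hf, hfX, rfl⟩ := mem_dualAnnihilator_tangentSpaceAt.mp hmem
      exact h f hf hfX _ (rep_mem_cone hx.1)

end DualCone

/-! ### Linear algebra of the dimension formula. -/

section LinearAlgebra

theorem finrank_eq_finrank_ker_add_finrank_map {M M' : Type*} [AddCommGroup M] [Module ℂ M]
    [FiniteDimensional ℂ M] [AddCommGroup M'] [Module ℂ M'] (ρ : M →ₗ[ℂ] M') {P : Submodule ℂ M}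
    (hP : LinearMap.ker ρ ≤ P) :
    Module.finrank ℂ P = Module.finrank ℂ (LinearMap.ker ρ) + Module.finrank ℂ (P.map ρ) := by
  have h := LinearMap.finrank_range_add_finrank_ker (ρ.domRestrict P)
  rw [LinearMap.range_domRestrict, LinearMap.ker_domRestrict] at h
  have h2 : Module.finrank ℂ ((LinearMap.ker ρ).submoduleOf P)
      = Module.finrank ℂ (LinearMap.ker ρ) :=
    (Submodule.submoduleOfEquivOfLe hP).finrank_eq
  have h3 : (LinearMap.ker ρ).submoduleOf P = (LinearMap.ker ρ).comap P.subtype := rfl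
  rw [h3] at h2
  omega

/-- The dimension of the space spanned by the conormal space of `T` and the image of `T` under a
bilinear form, in terms of the matrix of the form on `T`. -/
theorem finrank_conormal_sup_map {V : Type*} [AddCommGroup V] [Module ℂ V] [FiniteDimensional ℂ V]
    {T : Submodule ℂ V} {k : ℕ} {D : (Fin k → ℂ) →ₗ[ℂ] V} {v : V}
    (hD : ∀ τ, D τ ∈ T) (hT : ∀ δ ∈ T, ∃ (a : ℂ) (τ : Fin k → ℂ), δ = a • v + D τ)
    {H : V →ₗ[ℂ] Module.Dual ℂ V} (hHv : ∀ u ∈ T, H v u = 0) (hHD : ∀ u ∈ T, H u v = 0)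
    {M : Matrix (Fin k) (Fin k) ℂ}
    (hM : ∀ i j, H (D (Pi.single i 1)) (D (Pi.single j 1)) = -M i j) :
    Module.finrank ℂ (T.dualAnnihilator ⊔ T.map H : Submodule ℂ (Module.Dual ℂ V))
      + Module.finrank ℂ T = Module.finrank ℂ V + M.rank := by
  -- Restriction to `T` kills exactly the annihilator of `T`, so what remains of the sum is the
  -- image of `H ∘ D`, the vector `v` contributing nothing.
  let ρ : Module.Dual ℂ V →ₗ[ℂ] Module.Dual ℂ T := T.dualRestrict
  have hker : LinearMap.ker ρ = T.dualAnnihilator := T.dualRestrict_ker_eq_dualAnnihilator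
  have h1 := finrank_eq_finrank_ker_add_finrank_map ρ
    (P := T.dualAnnihilator ⊔ T.map H) (hker ▸ le_sup_left)
  have hmap : (T.dualAnnihilator ⊔ T.map H).map ρ = LinearMap.range (ρ ∘ₗ H ∘ₗ D) := by
    rw [Submodule.map_sup, ← hker, LinearMap.le_ker_iff_map.mp le_rfl, bot_sup_eq]
    ext ξ
    simp only [Submodule.mem_map, LinearMap.mem_range, LinearMap.comp_apply]
    constructor
    · rintro ⟨_, ⟨δ, hδ, rfl⟩, rfl⟩
      obtain ⟨a, τ, rfl⟩ := hT δ hδ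
      refine ⟨τ, ?_⟩
      ext u
      simp [ρ, hHv u u.2]
    · rintro ⟨τ, rfl⟩
      exact ⟨_, ⟨_, hD τ, rfl⟩, rfl⟩
  -- Evaluation on the vectors `D e_j` loses nothing on that image, since its members also vanish on
  -- `v`. In these coordinates `H ∘ D` becomes minus the transpose of `M`.
  let L : Module.Dual ℂ T →ₗ[ℂ] (Fin k → ℂ) :=
    LinearMap.pi fun j => LinearMap.applyₗ ⟨D (Pi.single j 1), hD _⟩
  have hL : ∀ ξ ∈ LinearMap.range (ρ ∘ₗ H ∘ₗ D), L ξ = 0 → ξ = 0 := by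
    rintro _ ⟨τ, rfl⟩ h
    ext ⟨u, hu⟩
    obtain ⟨a, σ, rfl⟩ := hT u hu
    have hj : ∀ j, H (D τ) (D (Pi.single j 1)) = 0 := fun j => congrFun h j
    have hσ : H (D τ) (D σ) = 0 := by
      rw [pi_eq_sum_univ' σ]
      simp only [map_sum, map_smul, hj, smul_zero, Finset.sum_const_zero]
    simp [ρ, hHD _ (hD τ), hσ]
  have h2 : Module.finrank ℂ (LinearMap.range (ρ ∘ₗ H ∘ₗ D)) = M.rank := by
    have e : Module.finrank ℂ ((LinearMap.range (ρ ∘ₗ H ∘ₗ D)).map L)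
        = Module.finrank ℂ (LinearMap.range (ρ ∘ₗ H ∘ₗ D)) := by
      rw [← LinearMap.range_domRestrict]
      refine LinearMap.finrank_range_of_inj ?_
      rw [← LinearMap.ker_eq_bot, LinearMap.ker_eq_bot']
      intro ξ hξ
      exact Subtype.ext (hL ξ ξ.2 hξ)
    have hLM : L ∘ₗ (ρ ∘ₗ H ∘ₗ D) = -M.transpose.mulVecLin := by
      refine LinearMap.pi_ext' fun i => LinearMap.ext_ring (funext fun j => ?_)
      have := hM i j
      simp [L, ρ, this]
    rw [← e, ← LinearMap.range_comp, hLM, LinearMap.range_neg, ← M.rank_transpose]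
    rfl
  have h3 := Subspace.finrank_add_finrank_dualAnnihilator_eq T
  rw [hmap, h2, hker] at h1
  omega

end LinearAlgebra

/-! ### Second differentials of polynomial functions. -/

section SecondDifferential

variable {V : Type*} [NormedAddCommGroup V] [NormedSpace ℂ V]

/-- The second differential of `f` at `v`. -/
noncomputable def secondDifferential (f : V → ℂ) (v : V) : V →ₗ[ℂ] Module.Dual ℂ V :=
  (ContinuousLinearMap.coeLM ℂ) ∘ₗ (fderiv ℂ (fderiv ℂ f) v).toLinearMap

theorem secondDifferential_apply (f : V → ℂ) (v δ u : V) :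
    secondDifferential f v δ u = fderiv ℂ (fderiv ℂ f) v δ u := rfl

variable [FiniteDimensional ℂ V]

theorem differentiableAt_fderiv_of_mem_polyFun {f : V → ℂ} (hf : f ∈ polyFun V) (v : V) :
    DifferentiableAt ℂ (fderiv ℂ f) v := (analyticAt_of_mem_polyFun hf v).fderiv.differentiableAt

theorem secondDifferential_eq {f : V → ℂ} (hf : f ∈ polyFun V) (v δ u : V) :
    secondDifferential f v δ u = fderiv ℂ (fun w => fderiv ℂ f w u) v δ := by
  rw [secondDifferential_apply,
    fderiv_clm_apply (differentiableAt_fderiv_of_mem_polyFun hf v) (differentiableAt_const u)]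
  simp

theorem secondDifferential_symm {f : V → ℂ} (hf : f ∈ polyFun V) (v δ u : V) :
    secondDifferential f v δ u = secondDifferential f v u δ := by
  have h : ContDiffAt ℂ ⊤ f v := (analyticAt_of_mem_polyFun hf v).contDiffAt
  exact (h.isSymmSndFDerivAt (by simp)).eq δ u

/-- The tangent space is constant along the ray through `v`, so `df(s • v)` kills `u` for all `s ≠
0`; differentiate at `s = 1`. -/
theorem secondDifferential_self {X : Set (ℙ ℂ V)} {f : V → ℂ} (hf : f ∈ polyFun V)
    (hfX : ∀ w ∈ cone X, f w = 0) {v u : V} (hu : u ∈ tangentSpaceAt (cone X) v) :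
    secondDifferential f v v u = 0 := by
  rw [secondDifferential_eq hf]
  have hs : HasFDerivAt (fun s : ℂ => s • v)
      ((ContinuousLinearMap.id ℂ ℂ).smulRight v) (1 : ℂ) :=
    (hasFDerivAt_id (1 : ℂ)).smul_const v
  have h0 : (fun s : ℂ => fderiv ℂ f (s • v) u) =ᶠ[𝓝 1] fun _ => 0 := by
    filter_upwards [eventually_ne_nhds one_ne_zero] with s hs
    rw [← coneTangentSpace_eq, ← coneTangentSpace_smul X hs, coneTangentSpace_eq,
      mem_tangentSpaceAt] at hu
    exact hu f hf hfX
  have h1 := (differentiableAt_of_mem_polyFun (fderiv_mem_polyFun hf u)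
    ((1 : ℂ) • v)).hasFDerivAt.comp (1 : ℂ) hs
  have h2 := h1.fderiv
  have h3 := h0.fderiv_eq (𝕜 := ℂ)
  rw [fderiv_fun_const] at h3
  have h4 := congrArg (fun L => L 1) (h2.symm.trans h3)
  simpa using h4

end SecondDifferential

/-! ### Derivatives of a local chart and the Hessian. -/

section LocalChart

variable {V : Type*} [NormedAddCommGroup V] [NormedSpace ℂ V] [FiniteDimensional ℂ V]
  {k : ℕ} {X : Set (ℙ ℂ V)} {x₀ : ℙ ℂ V} {T₀ : Module.Dual ℂ V} {T : Fin k → Module.Dual ℂ V}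
  {G : (Fin k → ℂ) → V}

/-- The second derivatives of a chart. -/
noncomputable def chartSecondDeriv (G : (Fin k → ℂ) → V) (i j : Fin k) : V :=
  fderiv ℂ (fun t => fderiv ℂ G t (Pi.single j 1)) 0 (Pi.single i 1)

theorem fderiv_dual_comp {E : Type*} [NormedAddCommGroup E] [NormedSpace ℂ E] {G : E → V} {t : E}
    (hG : DifferentiableAt ℂ G t) (U : Module.Dual ℂ V) (τ : E) :
    fderiv ℂ (fun t => U (G t)) t τ = U (fderiv ℂ G t τ) := by
  have h1 : HasFDerivAt (fun v => U v) U.toContinuousLinearMap (G t) :=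
    U.toContinuousLinearMap.hasFDerivAt
  have h2 : fderiv ℂ (fun t => U (G t)) t = _ := (h1.comp t hG.hasFDerivAt).fderiv
  rw [h2]
  rfl

omit [FiniteDimensional ℂ V] in
theorem hessianMatrix_congr {u u' : (Fin k → ℂ) → ℂ} (h : u =ᶠ[𝓝 0] u') :
    hessianMatrix u = hessianMatrix u' := by
  ext i j
  have : (fun t => fderiv ℂ u t (Pi.single j 1)) =ᶠ[𝓝 0]
      fun t => fderiv ℂ u' t (Pi.single j 1) :=
    (h.fderiv (𝕜 := ℂ)).mono fun t ht => by simp only [ht]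
  simp only [hessianMatrix, Matrix.of_apply, this.fderiv_eq]

theorem AnalyticAt.differentiableAt_fderiv_apply (hG : AnalyticAt ℂ G 0) (τ : Fin k → ℂ) :
    DifferentiableAt ℂ (fun t => fderiv ℂ G t τ) 0 :=
  hG.fderiv.differentiableAt.clm_apply (differentiableAt_const τ)

/-- The chart is normalised by `T₀ (G t) = 1`, so `u = U ∘ G` near the origin, and the linear form
`U` commutes with differentiation. -/
theorem IsLocalChart.hessianMatrix_eq (hc : IsLocalChart X x₀ T₀ T G) (U : Module.Dual ℂ V) :
    hessianMatrix (fun t => U (G t) / T₀ (G t))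
      = Matrix.of fun i j => U (chartSecondDeriv G i j) := by
  have h1 : (fun t => U (G t) / T₀ (G t)) =ᶠ[𝓝 0] fun t => U (G t) := by
    filter_upwards [hc.maps_to] with t ht
    rw [ht.2, div_one]
  rw [hessianMatrix_congr h1]
  ext i j
  have h2 : (fun t => fderiv ℂ (fun t => U (G t)) t (Pi.single j 1)) =ᶠ[𝓝 0]
      fun t => U (fderiv ℂ G t (Pi.single j 1)) := by
    filter_upwards [hc.analytic.eventually_analyticAt] with t ht
    exact fderiv_dual_comp ht.differentiableAt U _
  simp only [hessianMatrix, Matrix.of_apply, h2.fderiv_eq]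
  exact fderiv_dual_comp (AnalyticAt.differentiableAt_fderiv_apply hc.analytic _) U _

omit [FiniteDimensional ℂ V] in
theorem IsLocalChart.eventually_coord (hc : IsLocalChart X x₀ T₀ T G) (l : Fin k) :
    (fun t => T l (G t)) =ᶠ[𝓝 0] fun t => t l := by
  filter_upwards [hc.maps_to, hc.right_inv] with t h1 h2
  have := h2 l
  rwa [h1.2, div_one] at this

theorem IsLocalChart.coord_fderiv (hc : IsLocalChart X x₀ T₀ T G) (l : Fin k) (τ : Fin k → ℂ) :
    T l (fderiv ℂ G 0 τ) = τ l := by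
  rw [← fderiv_dual_comp hc.analytic.differentiableAt, (hc.eventually_coord l).fderiv_eq]
  exact fderiv_linear_apply (LinearMap.proj l : (Fin k → ℂ) →ₗ[ℂ] ℂ) 0 τ

theorem IsLocalChart.denominator_fderiv (hc : IsLocalChart X x₀ T₀ T G) (τ : Fin k → ℂ) :
    T₀ (fderiv ℂ G 0 τ) = 0 := by
  have : (fun t => T₀ (G t)) =ᶠ[𝓝 0] fun _ => 1 := hc.maps_to.mono fun t ht => ht.2
  rw [← fderiv_dual_comp hc.analytic.differentiableAt, this.fderiv_eq]
  simp

/-- Along the chart `T l` is the coordinate `t l`, which has no second derivatives. Hence adding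
multiples of the `T l` to `U` leaves the Hessian unchanged. -/
theorem IsLocalChart.coord_chartSecondDeriv (hc : IsLocalChart X x₀ T₀ T G) (l i j : Fin k) :
    T l (chartSecondDeriv G i j) = 0 := by
  have h1 := congrFun (congrFun (hc.hessianMatrix_eq (T l)) i) j
  have h2 : (fun t => T l (G t) / T₀ (G t)) =ᶠ[𝓝 0] fun t => t l :=
    hc.right_inv.mono fun t ht => ht l
  rw [hessianMatrix_congr h2] at h1
  refine (h1.symm.trans ?_ : Matrix.of (fun i j => T l (chartSecondDeriv G i j)) i j = 0)
  have h3 : ∀ t : Fin k → ℂ, fderiv ℂ (fun t : Fin k → ℂ => t l) t (Pi.single j 1)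
      = (Pi.single j 1 : Fin k → ℂ) l := fun t =>
    fderiv_linear_apply (LinearMap.proj l : (Fin k → ℂ) →ₗ[ℂ] ℂ) t _
  simp [hessianMatrix, h3]

omit [FiniteDimensional ℂ V] in
theorem IsLocalChart.center_mem_cone (hc : IsLocalChart X x₀ T₀ T G) :
    G 0 ∈ cone X ∧ T₀ (G 0) = 1 := hc.maps_to.self_of_nhds

omit [FiniteDimensional ℂ V] in
theorem IsLocalChart.center_ne_zero (hc : IsLocalChart X x₀ T₀ T G) : G 0 ≠ 0 := by
  intro h
  have := hc.center_mem_cone.2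
  rw [h, map_zero] at this
  exact zero_ne_one this

theorem IsLocalChart.fderiv_mem (hc : IsLocalChart X x₀ T₀ T G) (τ : Fin k → ℂ) :
    fderiv ℂ G 0 τ ∈ tangentSpaceAt (cone X) (G 0) :=
  fderiv_mem_tangentSpaceAt hc.analytic.differentiableAt (hc.maps_to.mono fun _ ht => ht.1) τ

/-- The tangent space of the cone at a smooth point is spanned by the point and the derivatives
of the chart. -/
theorem IsLocalChart.exists_eq_of_mem (hc : IsLocalChart X x₀ T₀ T G)
    (hsm : Module.finrank ℂ (tangentSpaceAt (cone X) (G 0)) = k + 1) {δ : V}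
    (hδ : δ ∈ tangentSpaceAt (cone X) (G 0)) :
    ∃ (a : ℂ) (τ : Fin k → ℂ), δ = a • G 0 + fderiv ℂ G 0 τ := by
  let L : (ℂ × (Fin k → ℂ)) →ₗ[ℂ] tangentSpaceAt (cone X) (G 0) :=
    LinearMap.codRestrict _ ((LinearMap.toSpanSingleton ℂ V (G 0)).coprod
      (fderiv ℂ G 0).toLinearMap) fun c => by
        refine add_mem (Submodule.smul_mem _ _ ?_) (hc.fderiv_mem _)
        exact self_mem_coneTangentSpace hc.center_mem_cone.1
  have hL : ∀ c, (L c : V) = c.1 • G 0 + fderiv ℂ G 0 c.2 := fun c => rfl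
  -- Both sides have dimension `k + 1`, so injectivity suffices: `T₀` reads off `a`, then the `T l`
  -- read off `τ`.
  have hinj : Function.Injective L := by
    rw [← LinearMap.ker_eq_bot, LinearMap.ker_eq_bot']
    intro c hcz
    have h0 : c.1 • G 0 + fderiv ℂ G 0 c.2 = 0 := by rw [← hL, hcz]; rfl
    have h1 : c.1 = 0 := by
      have := congrArg T₀ h0
      simpa [hc.center_mem_cone.2, hc.denominator_fderiv] using this
    refine Prod.ext h1 (funext fun l => ?_)
    rw [h1, zero_smul, zero_add] at h0
    exact (hc.coord_fderiv l c.2).symm.trans (by rw [h0, map_zero]; rfl)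
  have hsurj : Function.Surjective L :=
    (LinearMap.injective_iff_surjective_of_finrank_eq_finrank (by
      rw [hsm, Module.finrank_prod]; simp [add_comm])).mp hinj
  obtain ⟨c, hcδ⟩ := hsurj ⟨δ, hδ⟩
  exact ⟨c.1, c.2, by rw [← hL, hcδ]⟩

/-- The Hessian of the function `u` defined by a conormal vector `df` is, up to sign, the second
differential of `f` on the tangent space. -/
theorem IsLocalChart.secondDifferential_eq (hc : IsLocalChart X x₀ T₀ T G) {f : V → ℂ}
    (hf : f ∈ polyFun V) (hfX : ∀ w ∈ cone X, f w = 0) (i j : Fin k) :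
    secondDifferential f (G 0) (fderiv ℂ G 0 (Pi.single i 1)) (fderiv ℂ G 0 (Pi.single j 1))
      = -differential f (G 0) (chartSecondDeriv G i j) := by
  -- `df` kills the tangent vector `∂_j G` at every nearby point of the chart. The product rule in
  -- the direction `e_i` splits the derivative of this identity into the two terms compared.
  have h0 : (fun t => fderiv ℂ f (G t) (fderiv ℂ G t (Pi.single j 1))) =ᶠ[𝓝 0] fun _ => 0 := by
    filter_upwards [hc.analytic.eventually_analyticAt, hc.maps_to.eventually_nhds] with t h1 h2
    exact mem_tangentSpaceAt.mp (fderiv_mem_tangentSpaceAt h1.differentiableAt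
      (h2.mono fun _ h => h.1) (Pi.single j 1)) f hf hfX
  have h1 : HasFDerivAt (fun t => fderiv ℂ f (G t))
      ((fderiv ℂ (fderiv ℂ f) (G 0)).comp (fderiv ℂ G 0)) 0 :=
    (differentiableAt_fderiv_of_mem_polyFun hf (G 0)).hasFDerivAt.comp 0
      hc.analytic.differentiableAt.hasFDerivAt
  have h2 := (AnalyticAt.differentiableAt_fderiv_apply hc.analytic (Pi.single j 1)).hasFDerivAt
  have h3 := (h1.clm_apply h2).fderiv
  rw [h0.fderiv_eq, fderiv_fun_const] at h3
  have h4 := congrArg (fun L => L (Pi.single i 1)) h3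
  simp only [Pi.zero_apply, zero_apply, add_apply,
    ContinuousLinearMap.comp_apply, ContinuousLinearMap.flip_apply] at h4
  rw [secondDifferential_apply, differential_apply]
  exact eq_neg_of_add_eq_zero_right h4.symm

end LocalChart

/-! ### Criteria for algebraic independence and for dimension bounds. -/

section AlgebraicIndependence

variable {W : Type*} [AddCommGroup W] [Module ℂ W]

theorem algebraicIndependent_restrictHom_iff {Z : Set W} {σ : Type*} {y : σ → polyFun W} :
    AlgebraicIndependent ℂ (fun i => restrictHom Z (y i)) ↔
      ∀ p : MvPolynomial σ ℂ,
        (∀ z ∈ Z, MvPolynomial.eval (fun i => (y i : W → ℂ) z) p = 0) → p = 0 := by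
  rw [algebraicIndependent_iff]
  refine forall_congr' fun p => imp_congr_left ?_
  constructor
  · intro h z hz
    have h1 := coordinateRing_aeval_apply (fun i => restrictHom Z (y i)) p ⟨z, hz⟩
    rw [h] at h1
    exact h1.symm
  · intro h
    refine Subtype.ext (funext fun z => ?_)
    exact (coordinateRing_aeval_apply _ p z).trans (h z z.2)

end AlgebraicIndependence

theorem card_le_finrank_of_surjective {M : Type*} [AddCommGroup M] [Module ℂ M]
    [FiniteDimensional ℂ M] {R : Submodule ℂ M} {m : ℕ} (S : Fin m → Module.Dual ℂ M)
    (h : ∀ τ : Fin m → ℂ, ∃ ξ ∈ R, ∀ i, S i ξ = τ i) : m ≤ Module.finrank ℂ R := by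
  let L : R →ₗ[ℂ] (Fin m → ℂ) := LinearMap.pi fun i => (S i) ∘ₗ R.subtype
  have hL : Function.Surjective L := fun τ => by
    obtain ⟨ξ, hξ, h⟩ := h τ
    exact ⟨⟨ξ, hξ⟩, funext h⟩
  simpa using LinearMap.finrank_le_finrank_of_surjective hL

/-! ### The conormal map and the dimension of the dual cone. -/

section ConormalMap

variable {V : Type*} [NormedAddCommGroup V] [NormedSpace ℂ V] {s : ℕ} {F : Fin s → V → ℂ}

/-- Finitely many polynomial functions that generate the ideal of a set. -/
structure IsGeneratingFamily (Z : Set V) (F : Fin s → V → ℂ) : Prop where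
  mem : ∀ i, F i ∈ polyFun V
  vanish : ∀ i, ∀ z ∈ Z, F i z = 0
  exists_eq_sum : ∀ f ∈ polyFun V, (∀ z ∈ Z, f z = 0) →
    ∃ a : Fin s → V → ℂ, (∀ i, a i ∈ polyFun V) ∧ ∀ w, f w = ∑ i, a i w * F i w

/-- The linear combination of the differentials of the `F i` at a point with given
coefficients. -/
noncomputable def conormalMap (F : Fin s → V → ℂ) (z : V × (Fin s → ℂ)) : Module.Dual ℂ V :=
  ∑ i, z.2 i • differential (F i) z.1

/-- The linear combination of the `F i` with given coefficients. -/
def combination (F : Fin s → V → ℂ) (c : Fin s → ℂ) (w : V) : ℂ := ∑ i, c i * F i w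

theorem conormalMap_apply (F : Fin s → V → ℂ) (z : V × (Fin s → ℂ)) (u : V) :
    conormalMap F z u = ∑ i, z.2 i * fderiv ℂ (F i) z.1 u := by
  simp [conormalMap]

theorem combination_mem_polyFun (hF : ∀ i, F i ∈ polyFun V) (c : Fin s → ℂ) :
    combination F c ∈ polyFun V :=
  polyFun_sum_mem _ fun i _ => mul_mem (const_mem_polyFun (c i)) (hF i)

omit [NormedAddCommGroup V] [NormedSpace ℂ V] in
theorem combination_eq_zero {Z : Set V} (hF : ∀ i, ∀ z ∈ Z, F i z = 0) (c : Fin s → ℂ) :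
    ∀ z ∈ Z, combination F c z = 0 := fun z hz => by simp [combination, hF _ z hz]

variable [FiniteDimensional ℂ V]

theorem differential_combination (hF : ∀ i, F i ∈ polyFun V) (v : V) (c : Fin s → ℂ) :
    differential (combination F c) v = conormalMap F (v, c) := by
  ext u
  rw [conormalMap_apply, differential_apply]
  have h : HasFDerivAt (combination F c) (∑ i, c i • fderiv ℂ (F i) v) v :=
    HasFDerivAt.fun_sum fun i _ =>
      (differentiableAt_of_mem_polyFun (hF i) v).hasFDerivAt.const_mul (c i)
  rw [h.fderiv]
  simp

/-- In the product rule for `∑ a i * F i` the terms with `d(a i)` drop out at a point of `Z`,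
leaving coefficients `a i v`. -/
theorem IsGeneratingFamily.differential_eq {Z : Set V} (hF : IsGeneratingFamily Z F) {f : V → ℂ}
    (hf : f ∈ polyFun V) (hfZ : ∀ z ∈ Z, f z = 0) {v : V} (hv : v ∈ Z) :
    ∃ c, differential f v = conormalMap F (v, c) := by
  obtain ⟨a, ha, hfa⟩ := hF.exists_eq_sum f hf hfZ
  refine ⟨fun i => a i v, ?_⟩
  ext u
  rw [conormalMap_apply, differential_apply, show f = fun w => ∑ i, a i w * F i w from funext hfa]
  have h : HasFDerivAt (fun w => ∑ i, a i w * F i w)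
      (∑ i, (a i v • fderiv ℂ (F i) v + F i v • fderiv ℂ (a i) v)) v :=
    HasFDerivAt.fun_sum fun i _ => (differentiableAt_of_mem_polyFun (ha i) v).hasFDerivAt.mul
      (differentiableAt_of_mem_polyFun (hF.mem i) v).hasFDerivAt
  rw [h.fderiv]
  simp [hF.vanish _ v hv]

theorem IsGeneratingFamily.conormalMap_mem {Z : Set V} (hF : IsGeneratingFamily Z F) (v : V)
    (c : Fin s → ℂ) : conormalMap F (v, c) ∈ (tangentSpaceAt Z v).dualAnnihilator :=
  mem_dualAnnihilator_tangentSpaceAt.mpr ⟨_, combination_mem_polyFun hF.mem c,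
    combination_eq_zero hF.vanish c, differential_combination hF.mem v c⟩

theorem IsGeneratingFamily.exists_conormalMap_eq {Z : Set V} (hF : IsGeneratingFamily Z F) {v : V}
    (hv : v ∈ Z) {ξ : Module.Dual ℂ V} (hξ : ξ ∈ (tangentSpaceAt Z v).dualAnnihilator) :
    ∃ c, conormalMap F (v, c) = ξ := by
  obtain ⟨f, hf, hfZ, rfl⟩ := mem_dualAnnihilator_tangentSpaceAt.mp hξ
  obtain ⟨c, hc⟩ := hF.differential_eq hf hfZ hv
  exact ⟨c, hc.symm⟩

theorem comp_conormalMap_mem_polyFun (hF : ∀ i, F i ∈ polyFun V) {g : Module.Dual ℂ V → ℂ}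
    (hg : g ∈ polyFun (Module.Dual ℂ V)) :
    (fun z => g (conormalMap F z)) ∈ polyFun (V × (Fin s → ℂ)) := by
  induction hg using polyFun_induction with
  | linear φ =>
    obtain ⟨u, rfl⟩ := (Module.evalEquiv ℂ V).surjective φ
    simp only [Module.evalEquiv_apply, Module.Dual.eval_apply, conormalMap_apply]
    refine polyFun_sum_mem _ fun i _ => mul_mem ?_ ?_
    · exact polyFun_comp_linear (coord_mem_polyFun i) (LinearMap.snd ℂ V (Fin s → ℂ))
    · exact polyFun_comp_linear (fderiv_mem_polyFun (hF i) u) (LinearMap.fst ℂ V (Fin s → ℂ))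
  | const c => exact const_mem_polyFun c
  | add f g _ _ h1 h2 => exact add_mem h1 h2
  | mul f g _ _ h1 h2 => exact mul_mem h1 h2

/-- The derivative of the conormal map. -/
theorem fderiv_comp_conormalMap (hF : ∀ i, F i ∈ polyFun V) (φ : Module.Dual ℂ (Module.Dual ℂ V))
    (z δ : V × (Fin s → ℂ)) :
    fderiv ℂ (fun z => φ (conormalMap F z)) z δ = φ (conormalMap F (z.1, δ.2)
      + secondDifferential (combination F z.2) z.1 δ.1) := by
  obtain ⟨u, rfl⟩ := (Module.evalEquiv ℂ V).surjective φ
  simp only [Module.evalEquiv_apply, Module.Dual.eval_apply, LinearMap.add_apply]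
  rw [secondDifferential_eq (combination_mem_polyFun hF z.2)]
  have h0 : (fun w => fderiv ℂ (combination F z.2) w u)
      = fun w => ∑ i, z.2 i * fderiv ℂ (F i) w u := by
    funext w
    rw [← differential_apply, differential_combination hF, conormalMap_apply]
  have hd := fun i => differentiableAt_of_mem_polyFun (fderiv_mem_polyFun (hF i) u) z.1
  have h1 : HasFDerivAt (fun w => ∑ i, z.2 i * fderiv ℂ (F i) w u)
      (∑ i, z.2 i • fderiv ℂ (fun w => fderiv ℂ (F i) w u) z.1) z.1 :=
    HasFDerivAt.fun_sum fun i _ => (hd i).hasFDerivAt.const_mul (z.2 i)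
  rw [h0, h1.fderiv]
  simp only [conormalMap_apply]
  have h2 : ∀ i, HasFDerivAt (fun z : V × (Fin s → ℂ) => z.2 i)
      ((ContinuousLinearMap.proj i).comp (ContinuousLinearMap.snd ℂ V (Fin s → ℂ))) z :=
    fun i => ((ContinuousLinearMap.proj (R := ℂ) (φ := fun _ : Fin s => ℂ) i).comp
      (ContinuousLinearMap.snd ℂ V (Fin s → ℂ))).hasFDerivAt
  have h3 : ∀ i, HasFDerivAt (fun z : V × (Fin s → ℂ) => fderiv ℂ (F i) z.1 u)
      ((fderiv ℂ (fun w => fderiv ℂ (F i) w u) z.1).comp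
        (ContinuousLinearMap.fst ℂ V (Fin s → ℂ))) z :=
    fun i => (hd i).hasFDerivAt.comp z hasFDerivAt_fst
  have h4 : HasFDerivAt (fun z : V × (Fin s → ℂ) => ∑ i, z.2 i * fderiv ℂ (F i) z.1 u) _ z :=
    HasFDerivAt.fun_sum fun i _ => (h2 i).mul (h3 i)
  rw [h4.fderiv]
  simp [Finset.sum_add_distrib, mul_comm, add_comm]

theorem fst_mem_tangentSpaceAt {Z : Set V} {W : Type*} [NormedAddCommGroup W] [NormedSpace ℂ W]
    [FiniteDimensional ℂ W] {z δ : V × W} (hδ : δ ∈ tangentSpaceAt (Z ×ˢ (Set.univ : Set W)) z) :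
    δ.1 ∈ tangentSpaceAt Z z.1 := by
  rw [mem_tangentSpaceAt] at hδ ⊢
  intro f hf hfZ
  have h1 := hδ _ (polyFun_comp_linear hf (LinearMap.fst ℂ V W)) fun w hw => hfZ w.1 hw.1
  have h2 : HasFDerivAt (fun w : V × W => f (LinearMap.fst ℂ V W w)) _ z :=
    (differentiableAt_of_mem_polyFun hf z.1).hasFDerivAt.comp z hasFDerivAt_fst
  rw [h2.fderiv] at h1
  exact h1

/-- The tangent directions of the dual cone given by a conormal vector `df` at `v`. -/
noncomputable def conormalTangent (X : Set (ℙ ℂ V)) (f : V → ℂ) (v : V) :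
    Submodule ℂ (Module.Dual ℂ V) :=
  (tangentSpaceAt (cone X) v).dualAnnihilator
    ⊔ (tangentSpaceAt (cone X) v).map (secondDifferential f v)

section DualVariety

variable {X : Set (ℙ ℂ V)} (hX : IsProjectiveVariety X) (hdim : 0 < affineDim (cone X))
  (hF : IsGeneratingFamily (cone X) F)

include hX hdim hF

/-- Finitely many generators suffice because every conormal vector at a point of the cone is a
combination of their differentials. This presents the dual cone as the closure of the image of one
polynomial map. -/
theorem vanishes_on_dual_cone_iff_conormalMap {g : Module.Dual ℂ V → ℂ}
    (hg : g ∈ polyFun (Module.Dual ℂ V)) :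
    (∀ ξ ∈ cone (dualVariety X), g ξ = 0) ↔
      ∀ z ∈ cone X ×ˢ (Set.univ : Set (Fin s → ℂ)), g (conormalMap F z) = 0 := by
  rw [vanishes_on_dual_cone_iff hX hdim hg]
  constructor
  · rintro h ⟨v, c⟩ hz
    rw [← differential_combination hF.mem]
    exact h _ (combination_mem_polyFun hF.mem c) (combination_eq_zero hF.vanish c) v hz.1
  · intro h f hf hfX v hv
    obtain ⟨c, hc⟩ := hF.differential_eq hf hfX hv
    rw [hc]
    exact h (v, c) ⟨hv, trivial⟩

/-- Its ideal is the preimage, under pullback by the conormal map, of the prime ideal of `cone X ×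
ℂ^s`. -/
theorem isIrreducibleSet_dual_cone : IsIrreducibleSet (cone (dualVariety X)) := by
  refine ⟨⟨0, zero_mem_cone _⟩, fun f hf g hg h => ?_⟩
  have h1 := (vanishes_on_dual_cone_iff_conormalMap hX hdim hF (mul_mem hf hg)).mp h
  rw [vanishes_on_dual_cone_iff_conormalMap hX hdim hF hf,
    vanishes_on_dual_cone_iff_conormalMap hX hdim hF hg]
  exact hX.isIrreducibleSet_cone.prod_univ.2 _ (comp_conormalMap_mem_polyFun hF.mem hf) _
    (comp_conormalMap_mem_polyFun hF.mem hg) h1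

/-- At a general conormal vector, the tangent directions span a space of dimension at least that
of the dual cone. -/
theorem exists_generic_affineDim_le : ∃ q ∈ polyFun (V × (Fin s → ℂ)),
    (∃ z ∈ cone X ×ˢ (Set.univ : Set (Fin s → ℂ)), q z ≠ 0) ∧
      ∀ v ∈ cone X, ∀ c, q (v, c) ≠ 0 → affineDim (cone (dualVariety X))
        ≤ Module.finrank ℂ (conormalTangent X (combination F c) v) := by
  obtain ⟨S, hS⟩ := (isIrreducibleSet_dual_cone hX hdim hF).exists_linear_basis
  have hind := algebraicIndependent_restrictHom_iff.mp hS.1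
  obtain ⟨y, hyS⟩ : ∃ y : Fin (affineDim (cone (dualVariety X))) → polyFun (V × (Fin s → ℂ)),
      ∀ i, (y i : V × (Fin s → ℂ) → ℂ) = fun z => S i (conormalMap F z) :=
    ⟨fun i => ⟨_, comp_conormalMap_mem_polyFun hF.mem (linear_mem_polyFun (S i))⟩, fun _ => rfl⟩
  -- Independence survives the pullback because the conormal map is dominant.
  have hy : AlgebraicIndependent ℂ
      fun i => restrictHom (cone X ×ˢ (Set.univ : Set (Fin s → ℂ))) (y i) := by
    refine algebraicIndependent_restrictHom_iff.mpr fun p hp => hind p ?_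
    simp only [hyS] at hp
    exact (vanishes_on_dual_cone_iff_conormalMap hX hdim hF
      (aeval_mem_polyFun (fun i => linear_mem_polyFun (S i)) p)).mpr hp
  have hirr := hX.isIrreducibleSet_cone.prod_univ (W' := Fin s → ℂ)
  have hcl := hX.isAlgebraicSet_cone.prod_univ (W' := Fin s → ℂ)
  obtain ⟨q, hq, hq0, h⟩ := exists_generic_surjective hirr hcl hy
  refine ⟨q, hq, hq0, fun v hv c hqv => ?_⟩
  -- The derivative of the conormal map lands in `conormalTangent`, and the forms `S` already
  -- separate `affineDim` many directions of its image.
  refine card_le_finrank_of_surjective S fun τ => ?_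
  obtain ⟨⟨δ, hδt⟩, hδ⟩ := h (v, c) ⟨hv, trivial⟩ hqv τ
  have hδ1 : δ.1 ∈ tangentSpaceAt (cone X) v := fst_mem_tangentSpaceAt (z := (v, c)) hδt
  refine ⟨conormalMap F (v, δ.2) + secondDifferential (combination F c) v δ.1, ?_, fun i => ?_⟩
  · exact Submodule.add_mem_sup (hF.conormalMap_mem v δ.2) (Submodule.mem_map_of_mem hδ1)
  have h1 := fderiv_comp_conormalMap hF.mem (S i) (v, c) δ
  rw [← hyS i] at h1
  exact h1.symm.trans (congrFun hδ i)

/-- The tangent directions at a conormal vector at the centre of a smooth chart span a space of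
dimension at most that of the dual cone. -/
theorem finrank_conormalTangent_le {k : ℕ} {x₀ : ℙ ℂ V} {T₀ : Module.Dual ℂ V}
    {T : Fin k → Module.Dual ℂ V} {G : (Fin k → ℂ) → V} (hc : IsLocalChart X x₀ T₀ T G)
    (hsm : Module.finrank ℂ (tangentSpaceAt (cone X) (G 0)) = k + 1) (c : Fin s → ℂ) :
    Module.finrank ℂ (conormalTangent X (combination F c) (G 0))
      ≤ affineDim (cone (dualVariety X)) := by
  set R := conormalTangent X (combination F c) (G 0) with hR
  let b := Module.finBasis ℂ R
  -- Coordinates on the space `R` extend to linear forms on the dual space; they turn out to be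
  -- algebraically independent on the dual cone, which bounds the dimension of `R`.
  choose w hw using fun j => LinearMap.exists_extend (b.coord j)
  have hw' : ∀ j (ξ : R), w j ξ = b.coord j ξ := fun j ξ => LinearMap.congr_fun (hw j) ξ
  let y : Fin (Module.finrank ℂ R) → polyFun (Module.Dual ℂ V) := fun j =>
    ⟨fun ξ => w j ξ, linear_mem_polyFun (w j)⟩
  refine (isIrreducibleSet_dual_cone hX hdim hF).card_le_affineDim
    (y := fun j => restrictHom _ (y j)) ?_
  refine algebraicIndependent_restrictHom_iff.mpr fun p hp => ?_
  have hp' := (vanishes_on_dual_cone_iff_conormalMap hX hdim hF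
      (aeval_mem_polyFun (fun j => (y j).2) p)).mp hp
  -- The conormal map, parametrised by the chart and read in the coordinates `w`. It is a submersion
  -- at `(0, c)`, so a relation `p` among the `w j` would vanish on a neighbourhood of `E (0, c)`.
  let E : (Fin k → ℂ) × (Fin s → ℂ) → (Fin (Module.finrank ℂ R) → ℂ) := fun τ j =>
    w j (conormalMap F (G τ.1, τ.2))
  have hGa : AnalyticAt ℂ (fun τ : (Fin k → ℂ) × (Fin s → ℂ) => (G τ.1, τ.2)) (0, c) :=
    (hc.analytic.comp_of_eq analyticAt_fst rfl).prod analyticAt_snd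
  have hEa : AnalyticAt ℂ E (0, c) := by
    refine AnalyticAt.pi fun j => ?_
    exact (analyticAt_of_mem_polyFun (comp_conormalMap_mem_polyFun hF.mem
      (linear_mem_polyFun (w j))) (G 0, c)).comp_of_eq hGa rfl
  have hderiv : ∀ τ j, fderiv ℂ E (0, c) τ j = w j (conormalMap F (G 0, τ.2)
      + secondDifferential (combination F c) (G 0) (fderiv ℂ G 0 τ.1)) := by
    intro τ j
    have h1 : HasFDerivAt (fun τ : (Fin k → ℂ) × (Fin s → ℂ) => (G τ.1, τ.2))
        (((fderiv ℂ G 0).comp (ContinuousLinearMap.fst ℂ _ _)).prod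
          (ContinuousLinearMap.snd ℂ _ _)) (0, c) := by
      refine HasFDerivAt.prodMk ?_ hasFDerivAt_snd
      exact HasFDerivAt.comp (g := G) (0, c) hc.analytic.differentiableAt.hasFDerivAt
        hasFDerivAt_fst
    have h2 := (differentiableAt_of_mem_polyFun (comp_conormalMap_mem_polyFun hF.mem
      (linear_mem_polyFun (w j))) (G 0, c)).hasFDerivAt
    have h3 : HasFDerivAt (fun τ => E τ j) _ (0, c) := 
      HasFDerivAt.comp (g := fun z => w j (conormalMap F z)) (0, c) h2 h1
    have h4 := (hasFDerivAt_pi'.mp hEa.differentiableAt.hasFDerivAt j).unique h3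
    refine (congrArg (fun L => L τ) h4).trans ?_
    exact fderiv_comp_conormalMap hF.mem (w j) (G 0, c) _
  have hsurj : Function.Surjective (fderiv ℂ E (0, c)) := by
    intro τ
    obtain ⟨a, ha, _, ⟨u, hu, rfl⟩, hau⟩ := Submodule.mem_sup.mp (b.equivFun.symm τ).2
    obtain ⟨α, σ, rfl⟩ := hc.exists_eq_of_mem hsm hu
    -- The radial part of the tangent vector contributes a covector that kills the tangent space, so
    -- it is absorbed in the conormal summand.
    have ha' : a + secondDifferential (combination F c) (G 0) (α • G 0)
        ∈ (tangentSpaceAt (cone X) (G 0)).dualAnnihilator := by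
      refine add_mem ha ((Submodule.mem_dualAnnihilator _).mpr fun u hu => ?_)
      rw [map_smul, LinearMap.smul_apply, secondDifferential_self
        (combination_mem_polyFun hF.mem c) (combination_eq_zero hF.vanish c) hu, smul_zero]
    obtain ⟨d, hd⟩ := hF.exists_conormalMap_eq hc.center_mem_cone.1 ha'
    refine ⟨(σ, d), funext fun j => ?_⟩
    rw [hderiv, hd, add_assoc, ← map_add, hau, hw', b.coord_equivFun_symm]
  have hstrict : HasStrictFDerivAt E (fderiv ℂ E (0, c)) (0, c) :=
    hEa.hasStrictFDerivAt
  have hmap := hstrict.map_nhds_eq_of_surj (LinearMap.range_eq_top.mpr hsurj)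
  have hev : ∀ᶠ τ in 𝓝 (E (0, c)), MvPolynomial.eval τ p = 0 := by
    rw [← hmap, Filter.eventually_map]
    filter_upwards [continuous_fst.continuousAt.eventually hc.maps_to] with τ hτ
    exact hp' (G τ.1, τ.2) ⟨hτ.1, trivial⟩
  by_contra hp0
  obtain ⟨τ, h1, h2⟩ := (dense_eval_ne_zero hp0).inter_nhds_nonempty hev
  exact h1 h2

end DualVariety

end ConormalMap

/-! ### Existence of charts and the rank formula for Hessians. -/

section LocalHessian

variable {V : Type*} [NormedAddCommGroup V] [NormedSpace ℂ V] [FiniteDimensional ℂ V]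
  {X : Set (ℙ ℂ V)} {k : ℕ}

/-- Local charts exist at general points. -/
theorem exists_generic_localChart (hX : IsProjectiveVariety X)
    (hk : affineDim (cone X) = k + 1) :
    ∃ q ∈ polyFun V, (∃ z ∈ cone X, q z ≠ 0) ∧ ∀ v ∈ cone X, q v ≠ 0 →
      ∃ (x₀ : ℙ ℂ V) (T₀ : Module.Dual ℂ V) (T : Fin k → Module.Dual ℂ V) (G : (Fin k → ℂ) → V),
        IsSmoothPoint X x₀ ∧ IsLocalChart X x₀ T₀ T G ∧ G 0 = v := by
  have hZ := hX.isIrreducibleSet_cone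
  obtain ⟨S, hS⟩ : ∃ S : Fin (k + 1) → Module.Dual ℂ V, IsTranscendenceBasis ℂ fun i =>
      restrictHom (cone X) ⟨fun w => S i w, linear_mem_polyFun (S i)⟩ :=
    hk ▸ hZ.exists_linear_basis
  obtain ⟨q₁, hq₁, hq₁0, hchart⟩ := exists_generic_chart hZ hX.isAlgebraicSet_cone
    (y := fun i => ⟨fun w => S i w, linear_mem_polyFun (S i)⟩) hS
  obtain ⟨q₂, hq₂, hq₂0, hsm⟩ := exists_generic_finrank_tangent hZ hX.isAlgebraicSet_cone
  have hS0 : ∃ z ∈ cone X, S 0 z ≠ 0 := by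
    by_contra! h0
    exact hS.1.ne_zero 0 (Subtype.ext (funext fun z => h0 z z.2))
  have hq₂S := hZ.exists_mul_ne_zero hq₂ (linear_mem_polyFun (S 0)) hq₂0 hS0
  refine ⟨_, mul_mem hq₁ (mul_mem hq₂ (linear_mem_polyFun (S 0))),
    hZ.exists_mul_ne_zero hq₁ (mul_mem hq₂ (linear_mem_polyFun _)) hq₁0 hq₂S, fun v hv hqv => ?_⟩
  have ha : S 0 v ≠ 0 := right_ne_zero_of_mul (right_ne_zero_of_mul hqv)
  have hv0 : v ≠ 0 := by
    rintro rfl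
    exact ha (map_zero _)
  have hvx : v ∈ (Projectivization.mk ℂ v hv0).submodule := by
    rw [Projectivization.submodule_mk]; exact Submodule.mem_span_singleton_self v
  obtain ⟨G, hGa, hGv, hGZ, hGl⟩ := hchart v hv (left_ne_zero_of_mul hqv)
  set T₀ : Module.Dual ℂ V := (S 0 v)⁻¹ • S 0 with hT₀
  have hT₀v : T₀ v = 1 := by simp [hT₀, ha]
  have hT₀w : ∀ w, T₀ w = 1 ↔ S 0 w = S 0 v := fun w => by
    rw [hT₀, LinearMap.smul_apply, smul_eq_mul, inv_mul_eq_one₀ ha, eq_comm]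
  -- The chart of the cone has `k + 1` coordinates. Fixing the zeroth one at `S 0 v` is the
  -- normalisation `T₀ = 1`; the others are translated so that `v` is the centre.
  let ι : (Fin k → ℂ) → (Fin (k + 1) → ℂ) := fun t i => S i v + (Fin.cons 0 t : Fin (k + 1) → ℂ) i
  have hι0 : ι 0 = fun i => S i v := by
    funext i
    refine Fin.cases ?_ (fun i => ?_) i <;> simp [ι]
  have hιa : AnalyticAt ℂ ι 0 := by
    refine AnalyticAt.pi fun i => analyticAt_const.add ?_
    refine Fin.cases ?_ (fun i => ?_) i
    · simpa using analyticAt_const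
    · simpa using analyticAt_linear (LinearMap.proj i : (Fin k → ℂ) →ₗ[ℂ] ℂ) 0
  have hιc : Filter.Tendsto ι (𝓝 0) (𝓝 fun i => S i v) := hι0 ▸ hιa.continuousAt.tendsto
  have hmaps : ∀ᶠ t in 𝓝 (0 : Fin k → ℂ), G (ι t) ∈ cone X ∧ T₀ (G (ι t)) = 1 ∧
      ∀ i : Fin k, S i.succ (G (ι t)) = S i.succ v + t i := by
    filter_upwards [hιc.eventually hGZ] with t ht
    exact ⟨ht.1, (hT₀w _).mpr ((ht.2 0).trans (by simp [ι])),
      fun i => (ht.2 i.succ).trans (by simp [ι])⟩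
  -- Subtracting `S i.succ v • T₀` makes the coordinate forms vanish on the line of `v`.
  refine ⟨Projectivization.mk ℂ v hv0, T₀, fun i => S i.succ - S i.succ v • T₀, fun t => G (ι t),
    (isSmoothPoint_iff hv0 hvx hv).mpr (hsm v hv (left_ne_zero_of_mul (right_ne_zero_of_mul hqv))),
    ⟨?_, ?_, ?_, ?_, ?_, ?_, ?_⟩, ?_⟩
  · intro h
    rw [(Submodule.mem_dualAnnihilator _).mp h v hvx] at hT₀v
    exact zero_ne_one hT₀v
  · intro i
    rw [Submodule.mem_dualAnnihilator]
    intro w hw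
    rw [Projectivization.submodule_mk, Submodule.mem_span_singleton] at hw
    obtain ⟨b, rfl⟩ := hw
    simp [hT₀v]
  · simpa only [hι0, hGv] using hvx
  · exact hGa.comp_of_eq hιa hι0
  · exact hmaps.mono fun t ht => ⟨ht.1, ht.2.1⟩
  · filter_upwards [hmaps] with t ht i
    simp [ht.2.1, ht.2.2 i]
  · simp only [hι0, hGv]
    filter_upwards [hGl] with w hw hwX hw1
    convert hw hwX using 2
    funext i
    refine Fin.cases ?_ (fun i => ?_) i
    · simp [ι, (hT₀w w).mp hw1]
    · simp [ι, hw1]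
  · simp only [hι0, hGv]

theorem IsLocalChart.finrank_conormalTangent {x₀ : ℙ ℂ V} {T₀ : Module.Dual ℂ V}
    {T : Fin k → Module.Dual ℂ V} {G : (Fin k → ℂ) → V} (hc : IsLocalChart X x₀ T₀ T G)
    (hsm : Module.finrank ℂ (tangentSpaceAt (cone X) (G 0)) = k + 1) {f : V → ℂ}
    (hf : f ∈ polyFun V) (hfX : ∀ w ∈ cone X, f w = 0) :
    Module.finrank ℂ (conormalTangent X f (G 0)) + (k + 1) = Module.finrank ℂ V
      + (hessianMatrix fun t => differential f (G 0) (G t) / T₀ (G t)).rank := by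
  rw [← hsm]
  refine finrank_conormal_sup_map (D := (fderiv ℂ G 0).toLinearMap) (v := G 0) hc.fderiv_mem
    (fun δ hδ => hc.exists_eq_of_mem hsm hδ) (fun u hu => secondDifferential_self hf hfX hu)
    (fun u hu => ?_) fun i j => ?_
  · rw [secondDifferential_symm hf]
    exact secondDifferential_self hf hfX hu
  · rw [hc.hessianMatrix_eq]
    exact hc.secondDifferential_eq hf hfX i j

theorem IsLocalChart.finrank_tangentSpaceAt {x₀ : ℙ ℂ V} {T₀ : Module.Dual ℂ V}
    {T : Fin k → Module.Dual ℂ V} {G : (Fin k → ℂ) → V} (hc : IsLocalChart X x₀ T₀ T G)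
    (hx₀ : IsSmoothPoint X x₀) (hk : affineDim (cone X) = k + 1) :
    Module.finrank ℂ (tangentSpaceAt (cone X) (G 0)) = k + 1 :=
  hk ▸ (isSmoothPoint_iff hc.center_ne_zero hc.center hc.center_mem_cone.1).mp hx₀

/-- The Hessian of a linear form is that of a conormal vector. -/
theorem IsLocalChart.exists_conormal {x₀ : ℙ ℂ V} {T₀ : Module.Dual ℂ V}
    {T : Fin k → Module.Dual ℂ V} {G : (Fin k → ℂ) → V} (hc : IsLocalChart X x₀ T₀ T G)
    (hsm : Module.finrank ℂ (tangentSpaceAt (cone X) (G 0)) = k + 1) {U : Module.Dual ℂ V}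
    (hU : U ∈ x₀.submodule.dualAnnihilator) :
    ∃ U' ∈ (tangentSpaceAt (cone X) (G 0)).dualAnnihilator,
      hessianMatrix (fun t => U' (G t) / T₀ (G t)) = hessianMatrix fun t => U (G t) / T₀ (G t) := by
  -- Remove the first-order part of `u`: the difference kills `G 0` and all derivatives of the
  -- chart, hence the tangent space.
  refine ⟨U - ∑ l, U (fderiv ℂ G 0 (Pi.single l 1)) • T l, ?_, ?_⟩
  · rw [Submodule.mem_dualAnnihilator]
    intro δ hδ
    obtain ⟨a, τ, rfl⟩ := hc.exists_eq_of_mem hsm hδ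
    have h0 : ∀ {ξ : Module.Dual ℂ V}, ξ ∈ x₀.submodule.dualAnnihilator → ξ (G 0) = 0 :=
      fun hξ => (Submodule.mem_dualAnnihilator _).mp hξ _ hc.center
    have h1 : U (fderiv ℂ G 0 τ) = ∑ l, U (fderiv ℂ G 0 (Pi.single l 1)) * τ l := by
      conv_lhs => rw [pi_eq_sum_univ' τ]
      simp [mul_comm]
    simp [h0 hU, fun l => h0 (hc.mem_perp l), hc.coord_fderiv, h1]
  · rw [hc.hessianMatrix_eq, hc.hessianMatrix_eq]
    ext i j
    simp [hc.coord_chartSecondDeriv]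

variable (hX : IsProjectiveVariety X) (hk : affineDim (cone X) = k + 1)

include hX hk

/-- After passing to a conormal vector, the rank is read off from the dimension of
`conormalTangent`, which the dual cone bounds at every smooth chart. -/
theorem IsLocalHessian.rank_add_finrank_le {M : Matrix (Fin k) (Fin k) ℂ}
    (hM : IsLocalHessian X M) :
    M.rank + Module.finrank ℂ V ≤ affineDim (cone (dualVariety X)) + (k + 1) := by
  obtain ⟨x₀, T₀, T, G, U, hx₀, hc, hU, rfl⟩ := hM
  have hsm := hc.finrank_tangentSpaceAt hx₀ hk
  obtain ⟨s, F, hF, hFgen⟩ := exists_finite_generators (cone X)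
  have hF' : IsGeneratingFamily (cone X) F := ⟨fun i => (hF i).1, fun i => (hF i).2, hFgen⟩
  obtain ⟨U', hU', hUU'⟩ := hc.exists_conormal hsm hU
  obtain ⟨c, rfl⟩ := hF'.exists_conormalMap_eq hc.center_mem_cone.1 hU'
  have h1 := hc.finrank_conormalTangent hsm (combination_mem_polyFun hF'.mem c)
    (combination_eq_zero hF'.vanish c)
  rw [differential_combination hF'.mem, hUU'] at h1
  have h2 := finrank_conormalTangent_le hX (by omega) hF' hc hsm c
  omega

/-- Irreducibility of `cone X × ℂ^s` allows a pair `(v, c)` with maximal conormal directions whose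
`v` is also the centre of a smooth chart; take `U = df(v)` for the combination `f` given by `c`. -/
theorem exists_isLocalHessian_le : ∃ M : Matrix (Fin k) (Fin k) ℂ, IsLocalHessian X M ∧
    affineDim (cone (dualVariety X)) + (k + 1) ≤ M.rank + Module.finrank ℂ V := by
  obtain ⟨s, F, hF, hFgen⟩ := exists_finite_generators (cone X)
  have hF' : IsGeneratingFamily (cone X) F := ⟨fun i => (hF i).1, fun i => (hF i).2, hFgen⟩
  have hirr := hX.isIrreducibleSet_cone.prod_univ (W' := Fin s → ℂ)
  obtain ⟨q, hq, hq0, hle⟩ := exists_generic_affineDim_le hX (by omega) hF'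
  obtain ⟨r, hr, ⟨z, hz, hrz⟩, hchart⟩ := exists_generic_localChart hX hk
  obtain ⟨⟨v, c⟩, hvc, hqr⟩ := hirr.exists_mul_ne_zero hq
    (polyFun_comp_linear hr (LinearMap.fst ℂ V (Fin s → ℂ))) hq0 ⟨(z, 0), ⟨hz, trivial⟩, hrz⟩
  obtain ⟨x₀, T₀, T, G, hx₀, hc, rfl⟩ := hchart v hvc.1 (right_ne_zero_of_mul hqr)
  have hsm := hc.finrank_tangentSpaceAt hx₀ hk
  have h1 := hc.finrank_conormalTangent hsm (combination_mem_polyFun hF'.mem c)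
    (combination_eq_zero hF'.vanish c)
  have h2 := hle (G 0) hvc.1 c (left_ne_zero_of_mul hqr)
  refine ⟨_, ⟨x₀, T₀, T, G, differential (combination F c) (G 0), hx₀, hc, ?_, rfl⟩, by omega⟩
  rw [Submodule.mem_dualAnnihilator]
  intro w hw
  rw [← mk_eq_of_mem_submodule hc.center_ne_zero hc.center, Projectivization.submodule_mk,
    Submodule.mem_span_singleton] at hw
  obtain ⟨a, rfl⟩ := hw
  -- The centre is itself a tangent vector of the cone, so `df(v)` vanishes on the line `x₀`.
  have h3 := mem_tangentSpaceAt.mp (self_mem_coneTangentSpace hc.center_mem_cone.1) _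
    (combination_mem_polyFun hF'.mem c) (combination_eq_zero hF'.vanish c)
  rw [map_smul, differential_apply, h3, smul_zero]

omit [FiniteDimensional ℂ V] hX hk in
theorem defect_eq (X : Set (ℙ ℂ V)) :
    defect X = (Module.finrank ℂ V : ℤ) - affineDim (cone (dualVariety X)) - 1 := by
  rw [defect, codim, dim_eq_affineDim, Subspace.dual_finrank_eq]
  ring

theorem isLeast_defect : IsLeast {c : ℤ | ∃ M : Matrix (Fin k) (Fin k) ℂ,
    IsLocalHessian X M ∧ c = (k : ℤ) - (M.rank : ℤ)} (defect X) := by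
  rw [defect_eq]
  constructor
  · obtain ⟨M, hM, h⟩ := exists_isLocalHessian_le hX hk
    have := hM.rank_add_finrank_le hX hk
    exact ⟨M, hM, by omega⟩
  · rintro _ ⟨M, hM, rfl⟩
    have := hM.rank_add_finrank_le hX hk
    omega

/-- The defect vanishes if and only if some Hessian is invertible. -/
theorem affineDim_dual_cone_add_one_eq_iff :
    affineDim (cone (dualVariety X)) + 1 = Module.finrank ℂ V ↔
      ∃ M : Matrix (Fin k) (Fin k) ℂ, IsLocalHessian X M ∧ IsUnit M := by
  have hrank : ∀ M : Matrix (Fin k) (Fin k) ℂ, IsUnit M ↔ M.rank = k := fun M => by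
    refine ⟨fun h => by simpa using M.rank_of_isUnit h, fun h => ?_⟩
    rw [← Matrix.mulVec_surjective_iff_isUnit]
    have h1 : LinearMap.range M.mulVecLin = ⊤ := Submodule.eq_top_of_finrank_eq (by
      rw [Module.finrank_fin_fun]
      exact h)
    exact LinearMap.range_eq_top.mp h1
  simp only [hrank]
  obtain ⟨M, hM, h⟩ := exists_isLocalHessian_le hX hk
  constructor
  · intro h'
    have h1 := M.rank_le_card_width
    rw [Fintype.card_fin] at h1
    exact ⟨M, hM, by omega⟩
  · rintro ⟨M', hM', hr⟩
    have h1 := M.rank_le_card_width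
    rw [Fintype.card_fin] at h1
    have := hM'.rank_add_finrank_le hX hk
    omega

end LocalHessian

/-! ### Codimension one and hypersurfaces. -/

section Hypersurface

variable {W : Type*} [AddCommGroup W] [Module ℂ W] {ι : Type*} [Finite ι]
  (b : Module.Basis ι ℂ W)

/-- The coordinate ring as a quotient of the polynomial ring. -/
noncomputable def evalOn (Z : Set W) : MvPolynomial ι ℂ →ₐ[ℂ] coordinateRing Z :=
  MvPolynomial.aeval fun i => restrictHom Z ⟨fun w => b.coord i w, linear_mem_polyFun (b.coord i)⟩

omit [Finite ι] in
theorem evalOn_eq_zero_iff {Z : Set W} {p : MvPolynomial ι ℂ} :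
    evalOn b Z p = 0 ↔ ∀ z ∈ Z, MvPolynomial.eval (fun i => b.coord i z) p = 0 := by
  have h := coordinateRing_aeval_apply (Z := Z)
    (fun i => restrictHom Z ⟨fun w => b.coord i w, linear_mem_polyFun (b.coord i)⟩) p
  constructor
  · intro hp z hz
    refine (h ⟨z, hz⟩).symm.trans ?_
    exact congrArg (fun g : coordinateRing Z => g.1 ⟨z, hz⟩) hp
  · intro hp
    exact Subtype.ext (funext fun z => (h z).trans (hp z z.2))

theorem evalOn_surjective (Z : Set W) : Function.Surjective (evalOn b Z) := by
  intro a
  obtain ⟨⟨f, hf⟩, rfl⟩ := restrictHom_surjective Z a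
  obtain ⟨p, hp⟩ := exists_mvPolynomial_of_mem_polyFun b hf
  refine ⟨p, Subtype.ext (funext fun z => ?_)⟩
  exact (coordinateRing_aeval_apply _ p z).trans (hp z).symm

theorem eval_coord_smul (c : ℂ) (w : W) (p : MvPolynomial ι ℂ) :
    MvPolynomial.eval (fun i => b.coord i (c • w)) p = ∑ d ∈ Finset.range (p.totalDegree + 1),
      c ^ d * MvPolynomial.eval (fun i => b.coord i w) (p.homogeneousComponent d) := by
  conv_lhs => rw [← p.sum_homogeneousComponent, map_sum]
  exact Finset.sum_congr rfl fun d _ => (isForm_of_isHomogeneous b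
    (MvPolynomial.homogeneousComponent_isHomogeneous d p)).2 c w

variable [FiniteDimensional ℂ W]

theorem ringKrullDim_mvPolynomial_fin (n : ℕ) : ringKrullDim (MvPolynomial (Fin n) ℂ) = n := by
  rw [MvPolynomial.ringKrullDim_of_isNoetherianRing, ringKrullDim_eq_zero_of_field]
  simp

/-- A closed irreducible subset of codimension one is a hypersurface. -/
theorem isHypersurface_of_affineDim {Y : Set (ℙ ℂ W)} (hY : IsClosed[zariskiTopology W] Y)
    (hirr : IsIrreducibleSet (cone Y)) (hdim : affineDim (cone Y) + 1 = Module.finrank ℂ W) :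
    IsHypersurface Y := by
  have := hirr.isDomain
  have b := Module.finBasis ℂ W
  have hsurj := evalOn_surjective b (cone Y)
  set φ := evalOn b (cone Y) with hφ
  -- Otherwise all coordinates would be algebraically independent, one more than the dimension
  -- permits.
  have hI0 : RingHom.ker φ ≠ ⊥ := by
    intro h0
    have := hirr.card_le_affineDim (m := Module.finrank ℂ W)
      ((RingHom.injective_iff_ker_eq_bot _).mpr h0)
    omega
  have hprime : (RingHom.ker φ).IsPrime := RingHom.ker_isPrime φ
  obtain ⟨f, hfI, hf⟩ := hprime.exists_mem_prime_of_ne_bot hI0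
  -- The prime `f` generates the ideal: a member `g` outside `(f)` would make the dimension drop
  -- twice, first modulo `f` and then modulo `g`.
  have hdvd : ∀ g ∈ RingHom.ker φ, f ∣ g := by
    intro g hg
    by_contra hfg
    have hP : (Ideal.span {f}).IsPrime := (Ideal.span_singleton_prime hf.ne_zero).mpr hf
    have hle : Ideal.span {f} ≤ RingHom.ker φ := by
      rwa [Ideal.span_singleton_le_iff_mem]
    let ψ := Ideal.Quotient.lift (Ideal.span {f}) φ.toRingHom fun a ha => hle ha
    have hψ : Function.Surjective ψ := Ideal.Quotient.lift_surjective_of_surjective _ _ hsurj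
    have h1 := ringKrullDim_succ_le_of_surjective ψ hψ
      (r := Ideal.Quotient.mk _ g) (mem_nonZeroDivisors_of_ne_zero (by
        rwa [Ne, Ideal.Quotient.eq_zero_iff_mem, Ideal.mem_span_singleton])) hg
    have h2 := ringKrullDim_succ_le_of_surjective (Ideal.Quotient.mk (Ideal.span {f}))
      Ideal.Quotient.mk_surjective (mem_nonZeroDivisors_of_ne_zero hf.ne_zero)
      (Ideal.Quotient.eq_zero_iff_mem.mpr (Ideal.mem_span_singleton_self f))
    rw [ringKrullDim_mvPolynomial_fin] at h2
    rw [hirr.ringKrullDim_eq.1] at h1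
    have h3 : ((affineDim (cone Y) : WithBot ℕ∞) + 1) + 1 ≤ Module.finrank ℂ W :=
      le_trans (by gcongr) h2
    have h4 : affineDim (cone Y) + 1 + 1 ≤ Module.finrank ℂ W := by exact_mod_cast h3
    omega
  -- A nonzero homogeneous component of `f` lies in the ideal of the cone, so `f` divides it;
  -- comparing degrees, the quotient is constant, and the component is the required form.
  obtain ⟨d, hd⟩ : ∃ d, f.homogeneousComponent d ≠ 0 := by
    by_contra! h
    apply hf.ne_zero
    rw [← f.sum_homogeneousComponent]
    exact Finset.sum_eq_zero fun d _ => h d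
  have hdlt : d < f.totalDegree + 1 := by
    by_contra h
    exact hd (MvPolynomial.homogeneousComponent_eq_zero _ _ (by omega))
  have hhom := MvPolynomial.homogeneousComponent_isHomogeneous d f
  have hfd : f.homogeneousComponent d ∈ RingHom.ker φ := by
    refine (evalOn_eq_zero_iff b).mpr fun w hw => ?_
    exact eq_zero_of_sum_pow_mul_eq_zero
      (a := fun d => MvPolynomial.eval (fun i => b.coord i w) (f.homogeneousComponent d))
      (fun c => by
        rw [← eval_coord_smul]
        exact (evalOn_eq_zero_iff b).mp hfI _ (smul_mem_cone hw c)) d hdlt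
  obtain ⟨h, hh⟩ := hdvd _ hfd
  have hh0 : h ≠ 0 := by
    rintro rfl
    exact hd (by rw [hh, mul_zero])
  have hdeg := MvPolynomial.totalDegree_mul_of_isDomain hf.ne_zero hh0
  rw [← hh, hhom.totalDegree hd] at hdeg
  obtain ⟨a, rfl⟩ : ∃ a, h = MvPolynomial.C a :=
    ⟨_, MvPolynomial.totalDegree_eq_zero_iff_eq_C.mp (by omega)⟩
  have ha : a ≠ 0 := by
    rintro rfl
    exact hh0 (map_zero _)
  have hform := isForm_of_isHomogeneous b hhom
  refine ⟨d, _, ?_, hform, ?_, ?_⟩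
  · by_contra hd0
    have hf0 : f.totalDegree = 0 := by omega
    rw [MvPolynomial.totalDegree_eq_zero_iff_eq_C] at hf0
    have hc : f.coeff 0 ≠ 0 := by
      intro h0
      rw [h0, map_zero] at hf0
      exact hf.ne_zero hf0
    refine hf.not_isUnit ?_
    rw [hf0]
    exact (IsUnit.mk0 _ hc).map MvPolynomial.C
  · intro h0
    refine hd (MvPolynomial.funext fun x => ?_)
    have := congrFun h0 (b.equivFun.symm x)
    simpa only [b.coord_equivFun_symm, Pi.zero_apply, map_zero] using this
  · ext p
    rw [hform.mem_zeroLocus_iff]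
    constructor
    · intro hp
      exact (evalOn_eq_zero_iff b).mp hfd _ (rep_mem_cone hp)
    · intro hp
      have hfp : MvPolynomial.eval (fun i => b.coord i p.rep) f = 0 := by
        rw [hh, map_mul, MvPolynomial.eval_C] at hp
        exact (mul_eq_zero.mp hp).resolve_right ha
      have hpc : p.rep ∈ cone Y := by
        by_contra hpY
        obtain ⟨g, hg, hgY, hgp⟩ := exists_ne_zero_of_notMem_cone hY hpY
        obtain ⟨r, hr⟩ := exists_mvPolynomial_of_mem_polyFun b hg
        obtain ⟨r', rfl⟩ := hdvd r ((evalOn_eq_zero_iff b).mpr fun z hz => by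
          rw [← hr, hgY z hz])
        rw [hr, map_mul, hfp, zero_mul] at hgp
        exact hgp rfl
      simpa using hpc p.rep_nonzero

omit [FiniteDimensional ℂ W] in
/-- Polynomial functions restrict to polynomials on lines. -/
theorem exists_polynomial_line {f : W → ℂ} (hf : f ∈ polyFun W) (u e : W) :
    ∃ P : Polynomial ℂ, ∀ s : ℂ, f (u + s • e) = P.eval s := by
  induction hf using polyFun_induction with
  | linear φ =>
    exact ⟨Polynomial.C (φ u) + Polynomial.X * Polynomial.C (φ e),
      fun s => by simp [-Polynomial.X_mul_C]⟩
  | const c => exact ⟨Polynomial.C c, fun s => by simp⟩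
  | add f g _ _ h1 h2 =>
    obtain ⟨P, hP⟩ := h1
    obtain ⟨Q, hQ⟩ := h2
    exact ⟨P + Q, fun s => by simp [hP, hQ]⟩
  | mul f g _ _ h1 h2 =>
    obtain ⟨P, hP⟩ := h1
    obtain ⟨Q, hQ⟩ := h2
    exact ⟨P * Q, fun s => by simp [hP, hQ]⟩

omit [FiniteDimensional ℂ W] in
/-- A form of positive degree not vanishing at `e` has a zero on every line in the direction
of `e`. -/
theorem IsForm.exists_zero_on_line {d : ℕ} {f : W → ℂ} (hf : IsForm d f) (hd : 0 < d) {e : W}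
    (he : f e ≠ 0) (u : W) : ∃ s : ℂ, f (u + s • e) = 0 := by
  obtain ⟨P, hP⟩ := exists_polynomial_line hf.1 u e
  obtain ⟨Q, hQ⟩ := exists_polynomial_line hf.1 e u
  by_contra! hne
  have hdeg : P.degree = 0 := by
    by_contra h
    obtain ⟨s, hs⟩ := IsAlgClosed.exists_root P h
    exact hne s ((hP s).trans hs)
  rw [Polynomial.eq_C_of_degree_eq_zero hdeg] at hP
  simp only [Polynomial.eval_C] at hP
  -- If `f` is constant on the line, homogeneity gives `f(e + s u) = s^d f(u + s⁻¹ e)`, a constant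
  -- times `s^d`, for `s ≠ 0`. The factor `X` covers `s = 0`; evaluation there then gives `f e = 0`.
  have hQ' : Polynomial.X * (Q - Polynomial.C (P.coeff 0) * Polynomial.X ^ d) = 0 := by
    refine Polynomial.funext fun s => ?_
    by_cases hs : s = 0
    · simp [hs]
    · have : e + s • u = s • (u + s⁻¹ • e) := by
        rw [smul_add, smul_smul, mul_inv_cancel₀ hs, one_smul, add_comm]
      have h1 := hQ s
      rw [this, hf.2, hP] at h1
      rw [Polynomial.eval_mul, Polynomial.eval_sub, ← h1]
      simp only [Polynomial.eval_mul, Polynomial.eval_C, Polynomial.eval_pow, Polynomial.eval_X,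
        Polynomial.eval_zero]
      ring
  have hQ0 := (mul_eq_zero.mp hQ').resolve_left Polynomial.X_ne_zero
  have h0 := congrArg (Polynomial.eval 0) hQ0
  simp [← hQ, hd.ne'] at h0
  exact he h0

/-- Dividing by a nonzero polynomial lowers the Krull dimension, which gives one inequality. For the
other, projection along a direction `e` with `f e ≠ 0` maps the zero locus onto `W ⧸ ℂ ∙ e`, so the
coordinates of the quotient remain independent on it. -/
theorem IsHypersurface.affineDim_add_one {Y : Set (ℙ ℂ W)} (hY : IsHypersurface Y)
    (hirr : IsIrreducibleSet (cone Y)) : affineDim (cone Y) + 1 = Module.finrank ℂ W := by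
  obtain ⟨d, f, hd, hf, hf0, rfl⟩ := hY
  have hcone : ∀ w, w ∈ cone (zeroLocus f) ↔ f w = 0 := by
    intro w
    by_cases hw : w = 0
    · refine iff_of_true (hw ▸ zero_mem_cone _) ?_
      have := hf.2 0 0
      rwa [zero_smul, zero_pow hd.ne', zero_mul, ← hw] at this
    · rw [← hf.mem_zeroLocus_mk_iff hw]
      exact ⟨fun h => h hw, fun h _ => h⟩
  apply le_antisymm
  · have b := Module.finBasis ℂ W
    obtain ⟨p, hp⟩ := exists_mvPolynomial_of_mem_polyFun b hf.1
    have hp0 : p ≠ 0 := by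
      rintro rfl
      exact hf0 (funext fun w => by rw [hp, map_zero]; rfl)
    have h := ringKrullDim_succ_le_of_surjective (evalOn b (cone (zeroLocus f))).toRingHom
      (evalOn_surjective b _) (mem_nonZeroDivisors_of_ne_zero hp0)
      ((evalOn_eq_zero_iff b).mpr fun z hz => by rw [← hp]; exact (hcone z).mp hz)
    rw [ringKrullDim_mvPolynomial_fin, hirr.ringKrullDim_eq.1] at h
    exact_mod_cast h
  · obtain ⟨e, he⟩ := Function.ne_iff.mp hf0
    have he0 : e ≠ 0 := by
      rintro rfl
      exact he ((hcone 0).mp (zero_mem_cone _))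
    have hfin := Submodule.finrank_quotient_add_finrank (ℂ ∙ e)
    rw [finrank_span_singleton he0] at hfin
    have b := Module.finBasis ℂ (W ⧸ (ℂ ∙ e))
    have hind : AlgebraicIndependent ℂ fun i => restrictHom (cone (zeroLocus f))
        ⟨fun w => ((b.coord i) ∘ₗ (ℂ ∙ e).mkQ) w, linear_mem_polyFun _⟩ := by
      refine algebraicIndependent_restrictHom_iff.mpr fun p hp => MvPolynomial.funext fun x => ?_
      obtain ⟨u, hu⟩ := (ℂ ∙ e).mkQ_surjective (b.equivFun.symm x)
      obtain ⟨s, hs⟩ := hf.exists_zero_on_line hd he u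
      have h1 := hp _ ((hcone _).mpr hs)
      have h2 : (ℂ ∙ e).mkQ (u + s • e) = b.equivFun.symm x := by
        rw [map_add, map_smul, hu, Submodule.mkQ_apply, (Submodule.Quotient.mk_eq_zero _).mpr
          (Submodule.mem_span_singleton_self e : e ∈ ℂ ∙ e), smul_zero, add_zero]
      simp only [LinearMap.comp_apply, h2, b.coord_equivFun_symm] at h1
      rw [h1, map_zero]
    have := hirr.card_le_affineDim hind
    omega

end Hypersurface

end KatzDuality

theorem theorem6p1 {V : Type*} [NormedAddCommGroup V] [NormedSpace ℂ V] [FiniteDimensional ℂ V]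
    (X : Set (ℙ ℂ V)) (hX : KatzDuality.IsProjectiveVariety X)
    (k : ℕ) (hk : KatzDuality.dim X = k) :
    IsLeast {c : ℤ | ∃ M : Matrix (Fin k) (Fin k) ℂ,
        KatzDuality.IsLocalHessian X M ∧ c = (k : ℤ) - (M.rank : ℤ)} (KatzDuality.defect X) ∧
      (KatzDuality.IsHypersurface (KatzDuality.dualVariety X) ↔
        ∃ M : Matrix (Fin k) (Fin k) ℂ, KatzDuality.IsLocalHessian X M ∧ IsUnit M) := by
  have hk' : KatzDuality.affineDim (KatzDuality.cone X) = k + 1 := by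
    rw [KatzDuality.dim_eq_affineDim] at hk
    omega
  refine ⟨KatzDuality.isLeast_defect hX hk', ?_⟩
  obtain ⟨s, F, hF, hFgen⟩ := KatzDuality.exists_finite_generators (KatzDuality.cone X)
  have hirr := KatzDuality.isIrreducibleSet_dual_cone hX (by omega)
    ⟨fun i => (hF i).1, fun i => (hF i).2, hFgen⟩
  rw [← KatzDuality.affineDim_dual_cone_add_one_eq_iff hX hk', ← Subspace.dual_finrank_eq]
  refine ⟨fun h => h.affineDim_add_one hirr, fun h =>
    KatzDuality.isHypersurface_of_affineDim ?_ hirr h⟩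
  let _ := KatzDuality.zariskiTopology (Module.Dual ℂ V)
  exact isClosed_closure
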